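/- Logarithms are to the base $2$, $H_b(x)=-x\log x-(1-x)\log(1-x)$ and $p*x=p(1-x)+(1-p)x$. Let $p_A\in[0,\tfrac12]$, let $X^n$ be uniform on $\{0,1\}^n$, and let $Y^n$ be the output of a memoryless BSC$(p_A)$ with input $X^n$. **The construction.** Take $q\in[0,\tfrac12]$, $\delta>0$ and integers $n\ge 1$, $m_1,m_2\ge 0$ with $m_1+m_2\le n$ such that $m_1/n=H_b(q)-\delta$ and $(m_1+m_2)/n=H_b(q*p_A)+\delta$ up to rounding to integers (that is, $|m_1-n(H_b(q)-\delta)|<1$ and $|m_1+m_2-n(H_b(q*p_A)+\delta)|<1$). Choose uniformly at random a binary matrix $\mathbf H=\begin{bmatrix}\mathbf H_1\\ \mathbf H_2\end{bmatrix}$ of full rank $m_1+m_2$, where $\mathbf H_i$ is $m_i\times n$. Let $\mathcal C_1$ be the linear code with parity-check matrix $\mathbf H_1$, let $\mathcal C\subseteq\mathcal C_1$ be the one with parity-check matrix $\mathbf H$, and let $\mathbf G$ be a generator matrix of $\mathcal C$. Let $f_{\mathcal C}(s)$ be a sequence of minimum Hamming weight among those with syndrome $s$ with respect to $\mathbf H$.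 For $x\in\mathcal C_1$ let $\mathsf{Dec}_{\mathcal C}(x)$ be the information sequence $s\in\{0,1\}^{n-m_1-m_2}$ such that $s\mathbf G=x\oplus L(x\mathbf H_2^T)$, where $L(w)$ is a sequence of minimum Hamming weight in the coset $\{c\in\mathcal C_1: c\mathbf H_2^T=w\}$ of $\mathcal C$. The encoder quantizes $X^n$ to a codeword $X_q^n$ of $\mathcal C_1$ closest to $X^n$ in Hamming distance, stores $W=X_q^n\mathbf H_2^T$, and takes the key $S=\mathsf{Dec}_{\mathcal C}(X_q^n)$. The decoder computes $\widehat X_q^n=Y^n\oplus f_{\mathcal C}([0,W]\oplus Y^n\mathbf H^T)$ and $\widehat S=\mathsf{Dec}_{\mathcal C}(\widehat X_q^n)$. The key and helper-data alphabets are $\mathcal S=\{0,1\}^{n-m_1-m_2}$ and $\mathcal W=\{0,1\}^{m_2}$. **Achievability.** A tuple $(R_s,R_\ell,R_w)$ is achieved by the construction if there is $q\in[0,\tfrac12]$ such that for every $\epsilon>0$ there are $n,m_1,m_2,\delta$ as above for which, with probability at least $1-\epsilon$ over the choice of $\mathbf H$, the following hold for every choice of $\mathbf G$ and every way of breaking ties: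 $R_s=\frac1n\log|\mathcal S|$, $\Pr[\widehat S\ne S]\le\epsilon$, $\frac1nI(S;W)\le\epsilon$, $\frac1nH(S)\ge R_s-\epsilon$, $\frac1n\log|\mathcal W|\le R_w+\epsilon$ and $\frac1nI(X^n;W)\le R_\ell+\epsilon$. **Theorem.** The construction achieves the whole region $$\mathcal R_{\mathrm{gs,bin}}=\bigcup_{q\in[0,1/2]}\Big\{(R_s,R_\ell,R_w):\ 0\le R_s\le 1-H_b(q*p_A),\ R_\ell\ge H_b(q*p_A)-H_b(q),\ R_w\ge H_b(q*p_A)-H_b(q)\Big\}$$ of the generated-secret model: $\mathcal R_{\mathrm{gs,bin}}$ is contained in the closure of the set of tuples that are achieved by the construction. -/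

import Mathlib

/-! ### Information measures (base two) on a finite probability space -/

namespace KeyAgreement

noncomputable section

/-- The law of `f` when the sample point is drawn from the mass function `P`. -/
def law {Ω α : Type*} [Fintype Ω] (P : Ω → ℝ) (f : Ω → α) (a : α) : ℝ :=
  open Classical in ∑ ω with f ω = a, P ω

/-- The Shannon entropy `H(f)` in bits. -/
def entropy {Ω α : Type*} [Fintype Ω] [Fintype α] (P : Ω → ℝ) (f : Ω → α) : ℝ :=
  (∑ a, Real.negMulLog (law P f a)) / Real.log 2

/-- The mutual information `I(f; g)` in bits. -/
def mutualInfo {Ω α β : Type*} [Fintype Ω] [Fintype α] [Fintype β]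
    (P : Ω → ℝ) (f : Ω → α) (g : Ω → β) : ℝ :=
  entropy P f + entropy P g - entropy P (fun ω => (f ω, g ω))

/-- The binary entropy function `H_b` with logarithms to the base two. -/
def Hb (x : ℝ) : ℝ := Real.binEntropy x / Real.log 2

/-- `p * x = p (1 - x) + (1 - p) x`. -/
def conv (p x : ℝ) : ℝ := p * (1 - x) + (1 - p) * x

/-! ### The generated-secret model -/

/-- The joint mass function of `(X^n, Y^n)`: the source is i.i.d. with mass function `PX` and is
measured through the memoryless channel `PYX x y = P(Y = y | X = x)`. -/
def jointPMF {X Y : Type*} (n : ℕ) (PX : X → ℝ) (PYX : X → Y → ℝ)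
    (ω : (Fin n → X) × (Fin n → Y)) : ℝ :=
  ∏ i, PX (ω.1 i) * PYX (ω.1 i) (ω.2 i)

/-- A code for the generated-secret model: `(S, W) = Enc(X^n)` and `Ŝ = Dec(Y^n, W)`. -/
structure GSCode (X Y S W : Type*) (n : ℕ) where
  enc : (Fin n → X) → S × W
  dec : (Fin n → Y) → W → S

/-- The code has key rate exactly `Rs` and satisfies the reliability, weak secrecy, key uniformity,
storage and privacy constraints of the generated-secret model with slack `ε`. -/
def GSCode.Satisfies {X Y S W : Type*} [Fintype X] [Fintype Y] [Fintype S] [Fintype W] {n : ℕ}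
    (C : GSCode X Y S W n) (PX : X → ℝ) (PYX : X → Y → ℝ) (Rs Rl Rw ε : ℝ) : Prop :=
  let P := jointPMF n PX PYX
  let Xn : (Fin n → X) × (Fin n → Y) → (Fin n → X) := fun ω => ω.1
  let key : (Fin n → X) × (Fin n → Y) → S := fun ω => (C.enc ω.1).1
  let helper : (Fin n → X) × (Fin n → Y) → W := fun ω => (C.enc ω.1).2
  let keyHat : (Fin n → X) × (Fin n → Y) → S := fun ω => C.dec ω.2 (C.enc ω.1).2
  Rs = Real.logb 2 (Fintype.card S) / n ∧
  (open Classical in ∑ ω with keyHat ω ≠ key ω, P ω) ≤ ε ∧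
  mutualInfo P key helper / n ≤ ε ∧
  entropy P key / n ≥ Rs - ε ∧
  Real.logb 2 (Fintype.card W) / n ≤ Rw + ε ∧
  mutualInfo P Xn helper / n ≤ Rl + ε

/-- The uniform binary source. -/
def unifBit (_ : ZMod 2) : ℝ := 1 / 2

/-- The binary symmetric channel with crossover probability `p`. -/
def bsc (p : ℝ) (x y : ZMod 2) : ℝ := if y = x then 1 - p else p

/-- The region `R_gs,bin` of tuples `(Rs, Rl, Rw)` for crossover probability `p`. -/
def binRegion (p : ℝ) : Set (ℝ × ℝ × ℝ) :=
  {t | ∃ q ∈ Set.Icc (0 : ℝ) (1 / 2),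
    0 ≤ t.1 ∧ t.1 ≤ 1 - Hb (conv q p) ∧
    Hb (conv q p) - Hb q ≤ t.2.1 ∧
    Hb (conv q p) - Hb q ≤ t.2.2}

/-! ### The nested linear code construction -/

/-- A pair `(H₁, H₂)` of binary matrices, the two blocks of the stacked parity-check matrix. -/
abbrev ParityPair (n m₁ m₂ : ℕ) : Type :=
  Matrix (Fin m₁) (Fin n) (ZMod 2) × Matrix (Fin m₂) (Fin n) (ZMod 2)

/-- The stacked parity-check matrix `H = [H₁; H₂]`. -/
def ParityPair.stack {n m₁ m₂ : ℕ} (K : ParityPair n m₁ m₂) :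
    Matrix (Fin m₁ ⊕ Fin m₂) (Fin n) (ZMod 2) :=
  Matrix.fromRows K.1 K.2

/-- `H` has full (row) rank; then so do its blocks `H₁` and `H₂`. -/
def ParityPair.FullRank {n m₁ m₂ : ℕ} (K : ParityPair n m₁ m₂) : Prop :=
  K.stack.rank = m₁ + m₂

/-- A complete specification of the construction for given parity-check matrices. Here
`C₁ = ker H₁`, and `C = ker H` is a subcode of `C₁`. The fields record an admissible choice of
everything that the matrices leave open: a generator matrix of `C`, and the way in which ties
between sequences of equal distance or weight are broken. -/
structure WZScheme {n m₁ m₂ : ℕ} (K : ParityPair n m₁ m₂) where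
  /-- a generator matrix of `C` -/
  G : Matrix (Fin (n - (m₁ + m₂))) (Fin n) (ZMod 2)
  G_range : ∀ x, (∃ s, Matrix.vecMul s G = x) ↔ K.stack.mulVec x = 0
  /-- the vector quantizer: a codeword of `C₁` closest to the input in Hamming distance -/
  vq : (Fin n → ZMod 2) → (Fin n → ZMod 2)
  vq_mem : ∀ x, K.1.mulVec (vq x) = 0
  vq_min : ∀ x c, K.1.mulVec c = 0 → hammingDist x (vq x) ≤ hammingDist x c
  /-- the syndrome decoder `f_C`: a sequence of least weight with the given syndrome -/
  synDec : (Fin m₁ ⊕ Fin m₂ → ZMod 2) → (Fin n → ZMod 2)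
  synDec_syndrome : ∀ s, K.stack.mulVec (synDec s) = s
  synDec_min : ∀ s e, K.stack.mulVec e = s → hammingNorm (synDec s) ≤ hammingNorm e
  /-- a sequence of least weight in the coset of `C` in `C₁` that is indexed by `w` -/
  leader : (Fin m₂ → ZMod 2) → (Fin n → ZMod 2)
  leader_mem : ∀ w, K.1.mulVec (leader w) = 0
  leader_coset : ∀ w, K.2.mulVec (leader w) = w
  leader_min : ∀ w x, K.1.mulVec x = 0 → K.2.mulVec x = w → hammingNorm (leader w) ≤ hammingNorm x

namespace WZScheme

variable {n m₁ m₂ : ℕ} {K : ParityPair n m₁ m₂}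

/-- The demapping `Dec_C`: add to `x ∈ C₁` the leader of its coset of `C`, which gives a codeword of
`C`, and return the information sequence `s` with `s G` equal to that codeword. For `H` of full rank
the map `s ↦ s G` is a bijection onto `C`, so that `Function.invFun` is its true inverse there. -/
def demap (A : WZScheme K) (x : Fin n → ZMod 2) : Fin (n - (m₁ + m₂)) → ZMod 2 :=
  Function.invFun (fun s => Matrix.vecMul s A.G) (x + A.leader (K.2.mulVec x))

/-- The resulting code of the generated-secret model: the helper data are `W = X_q H₂ᵀ`, the key is
`S = Dec_C(X_q)`, and the decoder computes `X̂_q = Y + f_C([0, W] + Y Hᵀ)` and `Ŝ = Dec_C(X̂_q)`. -/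
def toGSCode (A : WZScheme K) :
    GSCode (ZMod 2) (ZMod 2) (Fin (n - (m₁ + m₂)) → ZMod 2) (Fin m₂ → ZMod 2) n where
  enc x := (A.demap (A.vq x), K.2.mulVec (A.vq x))
  dec y w := A.demap (y + A.synDec (Sum.elim (0 : Fin m₁ → ZMod 2) w + K.stack.mulVec y))

end WZScheme

/-- The probability that the construction meets the constraints of the generated-secret model with
slack `ε` at `(Rs, Rl, Rw)`, whatever the admissible choices are, when the pair of parity-check
matrices is drawn uniformly from those of full rank. -/
def successProb (p : ℝ) (n m₁ m₂ : ℕ) (Rs Rl Rw ε : ℝ) : ℝ :=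
  ({K : ParityPair n m₁ m₂ | K.FullRank ∧
      ∀ A : WZScheme K, A.toGSCode.Satisfies unifBit (bsc p) Rs Rl Rw ε}.ncard : ℝ) /
    ({K : ParityPair n m₁ m₂ | K.FullRank}.ncard : ℝ)

/-- The tuples that the construction achieves for the uniform binary source and the BSC(`p`): for
some distortion `q` and every `ε > 0` there are a blocklength `n`, a `δ > 0`, and sizes with
`m₁ / n = H_b(q) - δ` and `(m₁ + m₂) / n = H_b(q * p) + δ` up to rounding to integers, for which
the random code meets all the constraints with probability at least `1 - ε`. -/
def wzAchievable (p : ℝ) : Set (ℝ × ℝ × ℝ) :=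
  {t | ∃ q ∈ Set.Icc (0 : ℝ) (1 / 2), ∀ ε : ℝ, 0 < ε →
    ∃ n m₁ m₂ : ℕ, ∃ δ : ℝ, 1 ≤ n ∧ m₁ + m₂ ≤ n ∧ 0 < δ ∧
      |(m₁ : ℝ) - n * (Hb q - δ)| < 1 ∧
      |((m₁ : ℝ) + m₂) - n * (Hb (conv q p) + δ)| < 1 ∧
      1 - ε ≤ successProb p n m₁ m₂ t.1 t.2.1 t.2.2 ε}

/-- The rate region of the construction: the closure of the set of tuples that it achieves. -/
def wzRegion (p : ℝ) : Set (ℝ × ℝ × ℝ) := closure (wzAchievable p)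

end

end KeyAgreement

/-! Enlarging the distortion `q` raises `H_b(q * p)` and lowers `H_b(q * p) - H_b(q)`
(`antitoneOn_Hb_conv_sub_Hb`). So it suffices to treat points with `Rs = 1 - H_b(q * p)`. If `Rs =
0`, taking `m₁ + m₂ = n` makes the key trivial. Otherwise `p < 1/2`, and a random coding argument
applies.

Three counts carry that argument. Covering: a ball of radius `t` slightly below `q` still has many
more than `2 ^ m₁` words, so by a second moment bound (`sum_missed_le`) its words realize nearly all
syndromes of `H₁`, and nearly every input is quantized within `n t`. Packing: the decoder looks for
`e + z`, with `e` the quantization error and `z` the channel noise, whose weight is at most `n (q *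
p)` with high probability. It errs only if another word of that ball has the same syndrome. Each `e`
comes from at most `2 ^ (n - m₁)` inputs, so the expected error is at most about `|B_t| |B_r| / 2 ^
(2 m₁ + m₂)` with `r = q * p` (`sum_key_ne_le`, `sum_sum_noise_mul_confusions_le`), which is
exponentially small. Equivocation: `(S, W)` determines the quantized word, and at most `|B_t|`
well-quantized inputs share one, so `H(S, W)` is nearly `n - m₁` (`le_entropy_key_helper`). The
alphabets allow only `n - m₁ - m₂` bits for `S` and `m₂` for `W`, so near-uniformity of `S` and
near-independence follow together. Storage and leakage are both bounded by `log |W| = m₂`.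

For fixed matrices, these bounds hold for every generator matrix and every tie-breaking rule.
Averages are taken over all matrix pairs; at least half have full rank when `m₁ + m₂ < n`, so
Markov's inequality (`one_sub_le_successProb`) transfers to the conditioned ensemble. -/

namespace KeyAgreement

open Finset

/-! ### Entropy and mutual information on a finite space -/

section Entropy

variable {Ω α β : Type*} [Fintype Ω] {P : Ω → ℝ}

theorem law_nonneg (hP : ∀ ω, 0 ≤ P ω) (f : Ω → α) (a : α) : 0 ≤ law P f a :=
  Finset.sum_nonneg fun ω _ => hP ω

theorem sum_law [Fintype α] (f : Ω → α) : ∑ a, law P f a = ∑ ω, P ω := by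
  classical
  unfold law
  convert Finset.sum_fiberwise Finset.univ f P

theorem law_le_one [Fintype α] (hP : ∀ ω, 0 ≤ P ω) (h1 : ∑ ω, P ω = 1) (f : Ω → α) (a : α) :
    law P f a ≤ 1 := by
  rw [← h1, ← sum_law f]
  exact Finset.single_le_sum (fun b _ => law_nonneg hP f b) (Finset.mem_univ a)

theorem entropy_nonneg [Fintype α] (hP : ∀ ω, 0 ≤ P ω) (h1 : ∑ ω, P ω = 1) (f : Ω → α) :
    0 ≤ entropy P f :=
  div_nonneg (Finset.sum_nonneg fun a _ =>
    Real.negMulLog_nonneg (law_nonneg hP f a) (law_le_one hP h1 f a)) (Real.log_nonneg one_le_two)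

theorem entropy_le_logb_card [Fintype α] (hP : ∀ ω, 0 ≤ P ω) (h1 : ∑ ω, P ω = 1) (f : Ω → α) :
    entropy P f ≤ Real.logb 2 (Fintype.card α) := by
  unfold entropy Real.logb
  refine div_le_div_of_nonneg_right ?_ (Real.log_nonneg one_le_two)
  set N : ℝ := ((Fintype.card α : ℕ) : ℝ) with hNdef
  have hs : ∑ a, law P f a = 1 := (sum_law f).trans h1
  have hN : 0 < N := by
    rcases isEmpty_or_nonempty α with h | h
    · simp at hs
    · exact Nat.cast_pos.mpr Fintype.card_pos
  -- Gibbs' inequality termwise, from `log x ≤ x - 1`; the correction terms sum to zero.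
  have key : ∀ a, Real.negMulLog (law P f a) ≤ law P f a * Real.log N + (1 / N - law P f a) := by
    intro a
    rcases (law_nonneg hP f a).eq_or_lt with h | h
    · rw [← h]; simp [hN.le]
    · have := Real.log_le_sub_one_of_pos (x := 1 / (N * law P f a)) (by positivity)
      rw [one_div, Real.log_inv, Real.log_mul hN.ne' h.ne'] at this
      have h2 := mul_le_mul_of_nonneg_left this h.le
      have h3 : law P f a * ((N * law P f a)⁻¹ - 1) = 1 / N - law P f a := by
        field_simp
      rw [h3] at h2
      unfold Real.negMulLog
      linarith
  calc _ ≤ ∑ a, (law P f a * Real.log N + (1 / N - law P f a)) := Finset.sum_le_sum fun a _ => key a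
    _ = Real.log N := by
      rw [Finset.sum_add_distrib, ← Finset.sum_mul, Finset.sum_sub_distrib, hs]
      simp only [sum_const, card_univ, nsmul_eq_mul]
      field_simp
      rw [hNdef]; ring

theorem entropy_prod_graph [Fintype α] [Fintype β] (f : Ω → α) (g : α → β) :
    entropy P (fun ω => (f ω, g (f ω))) = entropy P f := by
  classical
  unfold entropy
  congr 1
  rw [Fintype.sum_prod_type]
  refine Finset.sum_congr rfl fun a _ => ?_
  rw [Finset.sum_eq_single (g a)]
  · congr 1
    unfold law
    refine Finset.sum_congr ?_ fun _ _ => rfl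
    ext ω
    simp only [mem_filter, mem_univ, true_and, Prod.mk.injEq, and_iff_left_iff_imp]
    rintro rfl; rfl
  · intro b _ hb
    have : law P (fun ω => (f ω, g (f ω))) (a, b) = 0 := by
      unfold law
      refine Finset.sum_eq_zero fun ω hω => ?_
      simp only [mem_filter, mem_univ, true_and, Prod.mk.injEq] at hω
      exact absurd (by rw [← hω.2, hω.1]) hb
    rw [this, Real.negMulLog_zero]
  · simp

/-- A function of `f` adds no entropy to `f`, so the mutual information is just the entropy of that
function. This bounds the privacy leakage by the storage rate. -/
theorem mutualInfo_apply_le [Fintype α] [Fintype β] (hP : ∀ ω, 0 ≤ P ω) (h1 : ∑ ω, P ω = 1)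
    (f : Ω → α) (g : α → β) :
    mutualInfo P f (fun ω => g (f ω)) ≤ Real.logb 2 (Fintype.card β) := by
  unfold mutualInfo
  rw [entropy_prod_graph f g]
  linarith [entropy_le_logb_card hP h1 (fun ω => g (f ω))]

theorem entropy_of_subsingleton [Fintype α] [Subsingleton α] (hP : ∀ ω, 0 ≤ P ω)
    (h1 : ∑ ω, P ω = 1) (f : Ω → α) : entropy P f = 0 := by
  refine le_antisymm ?_ (entropy_nonneg hP h1 f)
  refine (entropy_le_logb_card hP h1 f).trans (Real.logb_nonpos one_lt_two (by positivity) ?_)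
  exact_mod_cast Fintype.card_le_one_iff_subsingleton.mpr ‹_›

theorem mutualInfo_of_subsingleton_left [Fintype α] [Subsingleton α] [Fintype β]
    (hP : ∀ ω, 0 ≤ P ω) (h1 : ∑ ω, P ω = 1) (f : Ω → α) (g : Ω → β) :
    mutualInfo P f g = 0 := by
  classical
  unfold mutualInfo
  rw [entropy_of_subsingleton hP h1 f]
  have : entropy P (fun ω => (f ω, g ω)) = entropy P g := by
    unfold entropy
    congr 1
    rcases isEmpty_or_nonempty Ω with h | ⟨⟨ω₀⟩⟩
    · simp at h1
    · have : Unique α := ⟨⟨f ω₀⟩, fun a => Subsingleton.elim _ _⟩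
      rw [Fintype.sum_prod_type]
      simp only [univ_unique, sum_singleton]
      refine Finset.sum_congr rfl fun b _ => ?_
      congr 1
      unfold law
      refine Finset.sum_congr ?_ fun _ _ => rfl
      ext ω
      simp [Subsingleton.elim (f ω) default]
  rw [this]; ring

theorem sum_law_prod_right [Fintype β] (f : Ω → α) (g : Ω → β) (a : α) :
    ∑ b, law P (fun ω => (f ω, g ω)) (a, b) = law P f a := by
  classical
  unfold law
  rw [← Finset.sum_fiberwise (Finset.univ.filter fun ω => f ω = a) g P]
  refine Finset.sum_congr rfl fun b _ => ?_
  rw [Finset.filter_filter]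
  refine Finset.sum_congr ?_ fun _ _ => rfl
  ext ω
  simp

theorem sum_law_prod_left [Fintype α] (f : Ω → α) (g : Ω → β) (b : β) :
    ∑ a, law P (fun ω => (f ω, g ω)) (a, b) = law P g b := by
  classical
  unfold law
  rw [← Finset.sum_fiberwise (Finset.univ.filter fun ω => g ω = b) f P]
  refine Finset.sum_congr rfl fun a _ => ?_
  rw [Finset.filter_filter]
  refine Finset.sum_congr ?_ fun _ _ => rfl
  ext ω
  simp [and_comm]

theorem mutualInfo_nonneg [Fintype α] [Fintype β] (hP : ∀ ω, 0 ≤ P ω) (h1 : ∑ ω, P ω = 1)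
    (f : Ω → α) (g : Ω → β) : 0 ≤ mutualInfo P f g := by
  unfold mutualInfo entropy
  rw [← add_div, ← sub_div]
  refine div_nonneg ?_ (Real.log_nonneg one_le_two)
  rw [sub_nonneg, Fintype.sum_prod_type]
  set q : α → β → ℝ := fun a b => law P (fun ω => (f ω, g ω)) (a, b) with hq
  have hq0 : ∀ a b, 0 ≤ q a b := fun a b => law_nonneg hP _ _
  have hqa : ∀ a, ∑ b, q a b = law P f a := sum_law_prod_right f g
  have hqb : ∀ b, ∑ a, q a b = law P g b := sum_law_prod_left f g
  -- Again `log x ≤ x - 1`, at the ratio of the product law to the joint law.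
  have key : ∀ a b, Real.negMulLog (q a b) ≤
      q a b * -Real.log (law P f a) + q a b * -Real.log (law P g b) +
        (law P f a * law P g b - q a b) := by
    intro a b
    rcases (hq0 a b).eq_or_lt with h | h
    · rw [← h]
      simpa using mul_nonneg (law_nonneg hP f a) (law_nonneg hP g b)
    · have ha : 0 < law P f a := h.trans_le <| by
        rw [← hqa a]; exact Finset.single_le_sum (fun b _ => hq0 a b) (Finset.mem_univ b)
      have hb : 0 < law P g b := h.trans_le <| by
        rw [← hqb b]
        exact Finset.single_le_sum (f := fun a => q a b) (fun a _ => hq0 a b) (Finset.mem_univ a)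
      have h2 := Real.log_le_sub_one_of_pos (x := law P f a * law P g b / q a b) (by positivity)
      rw [Real.log_div (by positivity) h.ne', Real.log_mul ha.ne' hb.ne'] at h2
      have h3 := mul_le_mul_of_nonneg_left h2 h.le
      rw [mul_sub, mul_sub, mul_div_cancel₀ _ h.ne'] at h3
      unfold Real.negMulLog
      linarith
  refine (Finset.sum_le_sum fun a _ => Finset.sum_le_sum fun b _ => key a b).trans (le_of_eq ?_)
  simp only [Finset.sum_add_distrib, Finset.sum_sub_distrib]
  have e1 : ∑ a, ∑ b, q a b * -Real.log (law P f a) = ∑ a, Real.negMulLog (law P f a) := by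
    refine Finset.sum_congr rfl fun a _ => ?_
    rw [← Finset.sum_mul, hqa, Real.negMulLog]
    ring
  have e2 : ∑ a, ∑ b, q a b * -Real.log (law P g b) = ∑ b, Real.negMulLog (law P g b) := by
    rw [Finset.sum_comm]
    refine Finset.sum_congr rfl fun b _ => ?_
    rw [← Finset.sum_mul, hqb, Real.negMulLog]
    ring
  have e3 : ∑ a, ∑ b, law P f a * law P g b = 1 := by
    simp only [← Finset.mul_sum, sum_law, h1, mul_one]
  have e4 : ∑ a, ∑ b, q a b = 1 := by simp only [hqa, sum_law, h1]
  rw [e1, e2, e3, e4]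
  ring

/-- If outside a set of small probability every value of `f` has probability at most `exp (-c)`,
then the entropy of `f` is nearly `c` or more. -/
theorem le_entropy_of_fiber_le [Fintype α] (hP : ∀ ω, 0 ≤ P ω) (h1 : ∑ ω, P ω = 1) (f : Ω → α)
    (T : Ω → Prop) [DecidablePred T] [DecidableEq α] (c : ℝ)
    (hT : ∀ a, ∑ ω with f ω = a ∧ T ω, P ω ≤ Real.exp (-c)) :
    (∑ ω with T ω, P ω) * c - (1 - ∑ ω with T ω, P ω) ≤ entropy P f * Real.log 2 := by
  unfold entropy
  rw [div_mul_cancel₀ _ (Real.log_pos one_lt_two).ne']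
  set t : α → ℝ := fun a => ∑ ω with f ω = a ∧ T ω, P ω with ht
  have ht0 : ∀ a, 0 ≤ t a := fun a => Finset.sum_nonneg fun ω _ => hP ω
  have htl : ∀ a, t a ≤ law P f a := fun a => by
    unfold law
    refine Finset.sum_le_sum_of_subset_of_nonneg ?_ fun ω _ _ => hP ω
    intro ω
    simp only [mem_filter, mem_univ, true_and]
    exact fun h => h.1
  have hts : ∑ a, t a = ∑ ω with T ω, P ω := by
    rw [← Finset.sum_fiberwise (Finset.univ.filter T) f P]
    refine Finset.sum_congr rfl fun a _ => ?_
    rw [Finset.filter_filter]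
    refine Finset.sum_congr ?_ fun _ _ => rfl
    ext ω
    simp [and_comm]
  -- With `l = law P f a`, multiply `log l + c ≤ l e^c - 1` by `t a` and use `t a * e^c ≤ 1`. Then
  -- `t a ≤ l` and `log l ≤ 0` replace `t a * (-log l)` by `l * (-log l)`.
  have key : ∀ a, t a * c + (t a - law P f a) ≤ Real.negMulLog (law P f a) := by
    intro a
    rcases (law_nonneg hP f a).eq_or_lt with h | h
    · have : t a = 0 := le_antisymm ((htl a).trans h.ge) (ht0 a)
      rw [this, ← h]; simp
    · have hl1 := law_le_one hP h1 f a
      have h2 := Real.log_le_sub_one_of_pos (x := law P f a * Real.exp c) (by positivity)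
      rw [Real.log_mul h.ne' (Real.exp_pos c).ne', Real.log_exp] at h2
      have h3 : t a * Real.exp c ≤ 1 := by
        calc t a * Real.exp c ≤ Real.exp (-c) * Real.exp c := by
              gcongr
              exact hT a
          _ = 1 := by rw [← Real.exp_add]; simp
      have h4 := mul_le_mul_of_nonneg_left h2 (ht0 a)
      have h5 := mul_le_mul_of_nonneg_left h3 h.le
      have h6 := mul_le_mul_of_nonneg_right (htl a)
        (neg_nonneg.mpr (Real.log_nonpos h.le hl1))
      unfold Real.negMulLog
      nlinarith
  calc _ = ∑ a, (t a * c + (t a - law P f a)) := by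
        rw [Finset.sum_add_distrib, ← Finset.sum_mul, Finset.sum_sub_distrib, hts, sum_law, h1]
        ring
    _ ≤ _ := Finset.sum_le_sum fun a _ => key a

end Entropy

end KeyAgreement

namespace KeyAgreement

open Finset

/-! ### Noise concentration and the size of Hamming balls -/

section Noise

variable {n : ℕ}

/-- The mass function of the noise of a BSC(`p`) used `n` times. -/
noncomputable def noise (p : ℝ) (z : Fin n → ZMod 2) : ℝ := ∏ i, bsc p 0 (z i)

theorem zmod_two_sum (f : ZMod 2 → ℝ) : ∑ b, f b = f 0 + f 1 := Fin.sum_univ_two f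

theorem zmod_two_cases (b : ZMod 2) : b = 0 ∨ b = 1 := by
  revert b; decide

theorem bsc_nonneg {p : ℝ} (h0 : 0 ≤ p) (h1 : p ≤ 1) (x y : ZMod 2) : 0 ≤ bsc p x y := by
  unfold bsc; split_ifs <;> linarith

theorem bsc_zero_zero (p : ℝ) : bsc p 0 0 = 1 - p := by simp [bsc]

theorem bsc_zero_one (p : ℝ) : bsc p 0 1 = p := by simp [bsc]

theorem noise_nonneg {p : ℝ} (h0 : 0 ≤ p) (h1 : p ≤ 1) (z : Fin n → ZMod 2) : 0 ≤ noise p z :=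
  Finset.prod_nonneg fun _ _ => bsc_nonneg h0 h1 _ _

theorem sum_noise (p : ℝ) : ∑ z : Fin n → ZMod 2, noise p z = 1 := by
  unfold noise
  rw [← Fintype.prod_sum (fun (_ : Fin n) b => bsc p 0 b)]
  refine Finset.prod_eq_one fun i _ => ?_
  rw [zmod_two_sum, bsc_zero_zero, bsc_zero_one]
  ring

theorem exp_le_one_add_add_sq {u : ℝ} (hu : |u| ≤ 1) : Real.exp u ≤ 1 + u + u ^ 2 := by
  have := (abs_le.mp (Real.abs_exp_sub_one_sub_id_le hu)).2
  linarith

/-- A Chernoff bound for sums of independent centred functions of the noise bits. -/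
theorem sum_noise_le_exp {p : ℝ} (h0 : 0 ≤ p) (h1 : p ≤ 1) (g : Fin n → ZMod 2 → ℝ)
    (hg : ∀ i b, |g i b| ≤ 1) (hmean : ∀ i, (1 - p) * g i 0 + p * g i 1 = 0) {ζ : ℝ}
    (hζ0 : 0 ≤ ζ) (hζ1 : ζ ≤ 1) (E : (Fin n → ZMod 2) → Prop) [DecidablePred E]
    (hE : ∀ z, E z → n * ζ ≤ ∑ i, g i (z i)) :
    ∑ z with E z, noise p z ≤ Real.exp (-(n * ζ ^ 2 / 4)) := by
  -- The choice that minimizes the Chernoff exponent `n s ^ 2 - s n ζ`.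
  set s := ζ / 2
  have hmgf : ∑ z : Fin n → ZMod 2, noise p z * Real.exp (s * ∑ i, g i (z i)) ≤
      Real.exp (n * s ^ 2) := by
    have e1 : ∀ z : Fin n → ZMod 2, noise p z * Real.exp (s * ∑ i, g i (z i)) =
        ∏ i, (bsc p 0 (z i) * Real.exp (s * g i (z i))) := by
      intro z
      rw [Finset.prod_mul_distrib, Finset.mul_sum, Real.exp_sum]
      rfl
    rw [Finset.sum_congr rfl fun z _ => e1 z,
      ← Fintype.prod_sum (fun i b => bsc p 0 b * Real.exp (s * g i b)), Real.exp_nat_mul]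
    rw [show Real.exp (s ^ 2) ^ n = ∏ _i : Fin n, Real.exp (s ^ 2) by simp]
    refine Finset.prod_le_prod (fun i _ => Finset.sum_nonneg fun b _ =>
      mul_nonneg (bsc_nonneg h0 h1 _ _) (Real.exp_pos _).le) fun i _ => ?_
    have hsg : ∀ b, |s * g i b| ≤ 1 := fun b => by
      rw [abs_mul]
      have : |s| ≤ 1 := by rw [abs_le]; constructor <;> simp only [s] <;> linarith
      nlinarith [hg i b, abs_nonneg s, abs_nonneg (g i b)]
    have hb : ∀ b, Real.exp (s * g i b) ≤ 1 + s * g i b + s ^ 2 := fun b => by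
      have h2 : (g i b) ^ 2 ≤ 1 := by
        rw [← sq_abs]; nlinarith [hg i b, abs_nonneg (g i b)]
      have := exp_le_one_add_add_sq (hsg b)
      rw [mul_pow] at this
      nlinarith [sq_nonneg s]
    rw [zmod_two_sum, bsc_zero_zero, bsc_zero_one]
    calc _ ≤ (1 - p) * (1 + s * g i 0 + s ^ 2) + p * (1 + s * g i 1 + s ^ 2) := by
          have := hb 0; have := hb 1
          gcongr
      _ = 1 + s ^ 2 + s * ((1 - p) * g i 0 + p * g i 1) := by ring
      _ = s ^ 2 + 1 := by rw [hmean]; ring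
      _ ≤ _ := Real.add_one_le_exp _
  have hmul : Real.exp (s * (n * ζ)) * ∑ z with E z, noise p z ≤ Real.exp (n * s ^ 2) := by
    refine le_trans ?_ hmgf
    rw [Finset.mul_sum]
    refine le_trans (Finset.sum_le_sum (g := fun z => noise p z * Real.exp (s * ∑ i, g i (z i)))
      fun z hz => ?_) (Finset.sum_le_sum_of_subset_of_nonneg (Finset.filter_subset _ _)
      fun z _ _ => mul_nonneg (noise_nonneg h0 h1 z) (Real.exp_pos _).le)
    rw [mul_comm]
    have := hE z (Finset.mem_filter.mp hz).2
    refine mul_le_mul_of_nonneg_left (Real.exp_le_exp.mpr ?_) (noise_nonneg h0 h1 z)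
    exact mul_le_mul_of_nonneg_left this (by simp only [s]; linarith)
  rw [← le_div_iff₀' (Real.exp_pos _), ← Real.exp_sub] at hmul
  rwa [show -(n * ζ ^ 2 / 4) = n * s ^ 2 - s * (n * ζ) by simp only [s]; ring]

theorem hammingNorm_eq_sum (x : Fin n → ZMod 2) :
    (hammingNorm x : ℝ) = ∑ i, if x i ≠ 0 then (1 : ℝ) else 0 := by
  rw [Finset.sum_boole]; rfl

/-- The noise rarely carries a word of weight at most `n t` outside the ball of radius
`n (t * p)` by more than a fixed fraction of `n`. -/
theorem sum_noise_weight_add_gt {p t κ : ℝ} (h0 : 0 ≤ p) (h1 : p ≤ 1 / 2) (hκ0 : 0 ≤ κ)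
    (hκ1 : κ ≤ 1) (e : Fin n → ZMod 2) (he : (hammingNorm e : ℝ) ≤ n * t) :
    ∑ z with ¬ ((hammingNorm (e + z) : ℝ) ≤ n * (conv t p + κ)), noise p z ≤
      Real.exp (-(n * κ ^ 2 / 4)) := by
  -- The probability that coordinate `i` of `e + z` is nonzero.
  set m : Fin n → ℝ := fun i => if e i ≠ 0 then 1 - p else p with hm
  refine sum_noise_le_exp h0 (by linarith)
    (fun i b => (if e i + b ≠ 0 then (1 : ℝ) else 0) - m i) ?_ ?_ hκ0 hκ1 _ ?_
  · intro i b
    simp only [hm]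
    rw [abs_le]
    constructor <;> split_ifs <;> linarith
  · intro i
    rcases zmod_two_cases (e i) with h | h
    · simp [hm, h]
      ring
    · have : (1 : ZMod 2) + 1 = 0 := by decide
      simp [hm, h, this]
      ring
  · intro z hz
    rw [not_le, hammingNorm_eq_sum] at hz
    rw [Finset.sum_sub_distrib]
    have hms : ∑ i, m i = n * p + (1 - 2 * p) * hammingNorm e := by
      rw [hammingNorm_eq_sum, Finset.mul_sum]
      have : (n : ℝ) * p = ∑ i : Fin n, p := by simp
      rw [this, ← Finset.sum_add_distrib]
      refine Finset.sum_congr rfl fun i _ => ?_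
      simp only [hm]
      split_ifs <;> ring
    rw [hms]
    have h3 := mul_le_mul_of_nonneg_left he (show 0 ≤ 1 - 2 * p by linarith)
    simp only [Pi.add_apply] at hz
    unfold conv at hz
    nlinarith

/-- The Hamming ball of relative radius `t` about `0`. -/
noncomputable def ball (n : ℕ) (t : ℝ) : Finset (Fin n → ZMod 2) :=
  Finset.univ.filter fun x => (hammingNorm x : ℝ) ≤ n * t

theorem mem_ball {t : ℝ} {x : Fin n → ZMod 2} : x ∈ ball n t ↔ (hammingNorm x : ℝ) ≤ n * t := by
  simp [ball]

theorem noise_eq_exp {τ : ℝ} (h0 : 0 < τ) (h1 : τ < 1) (x : Fin n → ZMod 2) :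
    noise τ x = Real.exp (-(n * Real.binEntropy τ) -
      (hammingNorm x - n * τ) * Real.log ((1 - τ) / τ)) := by
  have e1 : noise τ x = ∏ i, Real.exp (Real.log (1 - τ) +
      (if x i ≠ 0 then 1 else 0) * (Real.log τ - Real.log (1 - τ))) := by
    unfold noise
    refine Finset.prod_congr rfl fun i _ => ?_
    rcases zmod_two_cases (x i) with h | h
    · simp [h, bsc_zero_zero, Real.exp_log (show 0 < 1 - τ by linarith)]
    · simp [h, bsc_zero_one, Real.exp_log h0]
  rw [e1, ← Real.exp_sum, Finset.sum_add_distrib, ← Finset.sum_mul, ← hammingNorm_eq_sum,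
    Real.log_div (by linarith) h0.ne']
  congr 1
  simp only [sum_const, card_univ, Fintype.card_fin, nsmul_eq_mul, Real.binEntropy, Real.log_inv]
  ring

theorem log_one_sub_div_nonneg {τ : ℝ} (h0 : 0 < τ) (h1 : τ ≤ 1 / 2) :
    0 ≤ Real.log ((1 - τ) / τ) :=
  Real.log_nonneg (by rw [le_div_iff₀ h0]; linarith)

/-- Under BSC(`τ`) noise, probability is nonincreasing in weight, so each word of the ball has at
least the mass found at its radius; the total mass is at most one. -/
theorem card_ball_le {τ ζ : ℝ} (h0 : 0 < τ) (h1 : τ ≤ 1 / 2) :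
    ((ball n (τ + ζ)).card : ℝ) ≤
      Real.exp (n * (Real.binEntropy τ + ζ * Real.log ((1 - τ) / τ))) := by
  have hL := log_one_sub_div_nonneg h0 h1
  set c := Real.exp (-(n * (Real.binEntropy τ + ζ * Real.log ((1 - τ) / τ)))) with hc
  have hge : ∀ x ∈ ball n (τ + ζ), c ≤ noise τ x := fun x hx => by
    rw [mem_ball] at hx
    rw [noise_eq_exp h0 (by linarith), hc, Real.exp_le_exp]
    nlinarith
  have hs : ((ball n (τ + ζ)).card : ℝ) * c ≤ 1 := by
    rw [← nsmul_eq_mul, ← sum_noise (n := n) τ]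
    refine (Finset.card_nsmul_le_sum _ _ _ hge).trans ?_
    exact Finset.sum_le_sum_of_subset_of_nonneg (Finset.subset_univ _)
      fun x _ _ => noise_nonneg h0.le (by linarith) x
  rw [hc, Real.exp_neg, mul_inv_le_iff₀ (Real.exp_pos _), one_mul] at hs
  exact hs

/-- The shell of weights within `n ζ` of `n τ` carries at least half of the BSC(`τ`) noise, since
the two tails together have mass at most `1 / 2`. Each word of the shell has mass at most that of
its inner edge. -/
theorem le_card_ball {τ ζ : ℝ} (h0 : 0 < τ) (h1 : τ ≤ 1 / 2) (hζ0 : 0 ≤ ζ) (hζ1 : ζ ≤ 1)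
    (hn : 2 * Real.exp (-(n * ζ ^ 2 / 4)) ≤ 1 / 2) :
    1 / 2 * Real.exp (n * (Real.binEntropy τ - ζ * Real.log ((1 - τ) / τ))) ≤
      ((ball n (τ + ζ)).card : ℝ) := by
  have hL := log_one_sub_div_nonneg h0 h1
  have hup : ∑ z : Fin n → ZMod 2 with ¬ ((hammingNorm z : ℝ) ≤ n * (τ + ζ)), noise τ z ≤
      Real.exp (-(n * ζ ^ 2 / 4)) := by
    have := sum_noise_weight_add_gt (n := n) (t := 0) h0.le h1 hζ0 hζ1 0 (by simp)
    simpa [conv] using this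
  have hlow : ∑ z : Fin n → ZMod 2 with ¬ (n * (τ - ζ) ≤ (hammingNorm z : ℝ)), noise τ z ≤
      Real.exp (-(n * ζ ^ 2 / 4)) := by
    refine sum_noise_le_exp h0.le (by linarith)
      (fun i b => τ - (if b ≠ 0 then (1 : ℝ) else 0)) ?_ ?_ hζ0 hζ1 _ ?_
    · intro i b
      rw [abs_le]
      constructor <;> split_ifs <;> linarith
    · intro i
      simp
      ring
    · intro z hz
      rw [not_le, hammingNorm_eq_sum] at hz
      rw [Finset.sum_sub_distrib]
      simp only [sum_const, card_univ, Fintype.card_fin, nsmul_eq_mul]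
      linarith
  set S := (ball n (τ + ζ)).filter fun z => n * (τ - ζ) ≤ (hammingNorm z : ℝ) with hS
  set c := Real.exp (-(n * (Real.binEntropy τ - ζ * Real.log ((1 - τ) / τ)))) with hc
  have hle : ∀ x ∈ S, noise τ x ≤ c := fun x hx => by
    rw [hS, mem_filter] at hx
    rw [noise_eq_exp h0 (by linarith), hc, Real.exp_le_exp]
    nlinarith [hx.2]
  have hcover : (1 : ℝ) ≤ ∑ z ∈ S, noise τ z +
      (∑ z : Fin n → ZMod 2 with ¬ ((hammingNorm z : ℝ) ≤ n * (τ + ζ)), noise τ z +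
      ∑ z : Fin n → ZMod 2 with ¬ (n * (τ - ζ) ≤ (hammingNorm z : ℝ)), noise τ z) := by
    rw [← sum_noise (n := n) τ, hS, ball, Finset.filter_filter, Finset.sum_filter,
      Finset.sum_filter, Finset.sum_filter, ← Finset.sum_add_distrib, ← Finset.sum_add_distrib]
    refine Finset.sum_le_sum fun z _ => ?_
    have := noise_nonneg h0.le (show τ ≤ 1 by linarith) z
    by_cases a1 : (hammingNorm z : ℝ) ≤ n * (τ + ζ) <;>
      by_cases a2 : n * (τ - ζ) ≤ (hammingNorm z : ℝ) <;> simp [a1, a2, this]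
  have hsum : ∑ z ∈ S, noise τ z ≤ (S.card : ℝ) * c := by
    rw [← nsmul_eq_mul]; exact Finset.sum_le_card_nsmul _ _ _ hle
  have hcard : (S.card : ℝ) ≤ (ball n (τ + ζ)).card := by
    exact_mod_cast Finset.card_le_card (Finset.filter_subset _ _)
  have hfin : 1 / 2 ≤ ((ball n (τ + ζ)).card : ℝ) * c := by
    have := mul_le_mul_of_nonneg_right hcard (Real.exp_pos _ : 0 < c).le
    linarith
  rw [hc, Real.exp_neg, ← div_eq_mul_inv, le_div_iff₀ (Real.exp_pos _)] at hfin
  exact hfin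

end Noise

end KeyAgreement

namespace KeyAgreement

open Finset

/-! ### Fibre counts and the second moment method -/

section Counting

theorem card_fiber_mul_card {A B : Type*} [AddGroup A] [AddGroup B] [Fintype A] [Fintype B]
    [DecidableEq B] (f : A →+ B) (hf : Function.Surjective f) (b : B) :
    (Finset.univ.filter fun a => f a = b).card * Fintype.card B = Fintype.card A := by
  have h : ∀ c, (Finset.univ.filter fun a => f a = c).card =
      (Finset.univ.filter fun a => f a = b).card := fun c =>
    AddMonoidHom.card_fiber_eq_of_mem_range f (hf c) (hf b)
  have := Finset.card_eq_sum_card_fiberwise (f := f) (s := Finset.univ) (t := Finset.univ)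
    (fun _ _ => Finset.mem_coe.mpr (Finset.mem_univ _))
  rw [Finset.sum_congr rfl fun c _ => h c, Finset.sum_const, smul_eq_mul, Finset.card_univ,
    Finset.card_univ] at this
  rw [this, mul_comm]

/-- A second moment bound for the number of points missed by a map with few collisions. -/
theorem card_missed_mul_le {A S : Type*} [Fintype S] [DecidableEq S] (B : Finset A) (f : A → S) :
    ((Finset.univ.filter fun s => ∀ e ∈ B, f e ≠ s).card : ℝ) *
        ((B.card : ℝ) / Fintype.card S) ^ 2 ≤
      (((B ×ˢ B).filter fun x => f x.1 = f x.2).card : ℝ) - (B.card : ℝ) ^ 2 / Fintype.card S := by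
  classical
  rcases isEmpty_or_nonempty S with hS | hS
  · simp
  set N : S → ℝ := fun s => ((B.filter fun e => f e = s).card : ℝ) with hN
  set μ : ℝ := (B.card : ℝ) / Fintype.card S with hμ
  have hcard : (0 : ℝ) < Fintype.card S := Nat.cast_pos.mpr Fintype.card_pos
  have h1 : ∑ s, N s = B.card := by
    simp only [hN]
    rw [← Nat.cast_sum, ← Finset.card_eq_sum_card_fiberwise
      (fun _ _ => Finset.mem_coe.mpr (Finset.mem_univ _))]
  have h2 : ∑ s, N s ^ 2 = ((B ×ˢ B).filter fun x => f x.1 = f x.2).card := by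
    rw [Finset.card_eq_sum_card_fiberwise (f := fun x : A × A => f x.1) (t := Finset.univ)
      (fun _ _ => Finset.mem_coe.mpr (Finset.mem_univ _)), Nat.cast_sum]
    refine Finset.sum_congr rfl fun s _ => ?_
    simp only [hN]
    rw [sq, ← Nat.cast_mul, ← Finset.card_product]
    congr 2
    ext x
    simp only [mem_product, mem_filter]
    constructor
    · rintro ⟨⟨a, b⟩, c, d⟩; exact ⟨⟨⟨a, c⟩, b.trans d.symm⟩, b⟩
    · rintro ⟨⟨⟨a, c⟩, d⟩, b⟩; exact ⟨⟨a, b⟩, c, d ▸ b⟩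
  -- The right side is the variance sum of the occupation numbers, and each missed point contributes
  -- `μ ^ 2` to it.
  have h3 : ∑ s, (N s - μ) ^ 2 =
      (((B ×ˢ B).filter fun x => f x.1 = f x.2).card : ℝ) - (B.card : ℝ) ^ 2 / Fintype.card S := by
    have e : ∀ s, (N s - μ) ^ 2 = N s ^ 2 - 2 * μ * N s + μ ^ 2 := fun s => by ring
    rw [Finset.sum_congr rfl fun s _ => e s, Finset.sum_add_distrib, Finset.sum_sub_distrib,
      ← Finset.mul_sum, h1, h2]
    simp only [sum_const, card_univ, nsmul_eq_mul, hμ]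
    field_simp
    ring
  rw [← h3, ← nsmul_eq_mul, ← Finset.sum_const]
  refine le_trans (Finset.sum_le_sum (g := fun s => (N s - μ) ^ 2) fun s hs => ?_)
    (Finset.sum_le_sum_of_subset_of_nonneg (Finset.subset_univ _) fun s _ _ => sq_nonneg _)
  have : N s = 0 := by
    simp only [hN, Nat.cast_eq_zero, Finset.card_eq_zero]
    exact Finset.filter_eq_empty_iff.mpr fun e he => (Finset.mem_filter.mp hs).2 e he
  simp [this]

end Counting

/-! ### Random parity-check matrices -/

section Matrices

variable {n m₁ m₂ : ℕ}

theorem exists_eq_one_of_ne_zero {ι : Type*} {v : ι → ZMod 2} (hv : v ≠ 0) : ∃ j, v j = 1 := by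
  obtain ⟨j, hj⟩ := Function.ne_iff.mp hv
  exact ⟨j, (zmod_two_cases (v j)).resolve_left hj⟩

theorem mulVec_surjective_left {ι κ : Type*} [Fintype κ] [DecidableEq κ] {v : κ → ZMod 2}
    (hv : v ≠ 0) : Function.Surjective fun M : Matrix ι κ (ZMod 2) => M.mulVec v := by
  obtain ⟨j, hj⟩ := exists_eq_one_of_ne_zero hv
  intro w
  refine ⟨Matrix.of fun i k => if k = j then w i else 0, ?_⟩
  ext i
  simp [Matrix.mulVec, dotProduct, hj]

theorem vecMul_surjective_right {ι κ : Type*} [Fintype ι] [DecidableEq ι] {u : ι → ZMod 2}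
    (hu : u ≠ 0) : Function.Surjective fun M : Matrix ι κ (ZMod 2) => Matrix.vecMul u M := by
  obtain ⟨j, hj⟩ := exists_eq_one_of_ne_zero hu
  intro w
  refine ⟨Matrix.of fun i k => if i = j then w k else 0, ?_⟩
  ext i
  simp [Matrix.vecMul, dotProduct, hj]

theorem stack_surjective :
    Function.Surjective (ParityPair.stack : ParityPair n m₁ m₂ → _) := fun M =>
  ⟨(M.toRows₁, M.toRows₂), Matrix.fromRows_toRows M⟩

theorem stack_add (K L : ParityPair n m₁ m₂) : (K + L).stack = K.stack + L.stack := by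
  ext i j
  rcases i with i | i <;> simp [ParityPair.stack]

theorem card_syndrome (m : ℕ) : Fintype.card (Fin m → ZMod 2) = 2 ^ m := by simp

theorem card_fst_mulVec_eq_zero {v : Fin n → ZMod 2} (hv : v ≠ 0) :
    (Finset.univ.filter fun K : ParityPair n m₁ m₂ => K.1.mulVec v = 0).card * 2 ^ m₁ =
      Fintype.card (ParityPair n m₁ m₂) := by
  have := card_fiber_mul_card (A := ParityPair n m₁ m₂) (B := Fin m₁ → ZMod 2)
    (AddMonoidHom.mk' (fun K => K.1.mulVec v) fun K L => by simp [Matrix.add_mulVec])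
    ((mulVec_surjective_left hv).comp Prod.fst_surjective) 0
  rwa [card_syndrome] at this

theorem card_stack_mulVec_eq_zero {v : Fin n → ZMod 2} (hv : v ≠ 0) :
    (Finset.univ.filter fun K : ParityPair n m₁ m₂ => K.stack.mulVec v = 0).card * 2 ^ (m₁ + m₂) =
      Fintype.card (ParityPair n m₁ m₂) := by
  have := card_fiber_mul_card (A := ParityPair n m₁ m₂) (B := Fin m₁ ⊕ Fin m₂ → ZMod 2)
    (AddMonoidHom.mk' (fun K => K.stack.mulVec v) fun K L => by
      rw [stack_add, Matrix.add_mulVec])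
    ((mulVec_surjective_left hv).comp stack_surjective) 0
  simpa using this

theorem card_vecMul_stack_eq_zero {u : Fin m₁ ⊕ Fin m₂ → ZMod 2} (hu : u ≠ 0) :
    (Finset.univ.filter fun K : ParityPair n m₁ m₂ => Matrix.vecMul u K.stack = 0).card * 2 ^ n =
      Fintype.card (ParityPair n m₁ m₂) := by
  have := card_fiber_mul_card (A := ParityPair n m₁ m₂) (B := Fin n → ZMod 2)
    (AddMonoidHom.mk' (fun K => Matrix.vecMul u K.stack) fun K L => by
      rw [stack_add, Matrix.vecMul_add])
    ((vecMul_surjective_right hu).comp stack_surjective) 0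
  rwa [card_syndrome] at this

theorem exists_vecMul_eq_zero_of_not_fullRank {K : ParityPair n m₁ m₂} (hK : ¬ K.FullRank) :
    ∃ u, u ≠ 0 ∧ Matrix.vecMul u K.stack = 0 := by
  by_contra! h
  apply hK
  have hli : LinearIndependent (ZMod 2) K.stack.row := by
    rw [← Matrix.vecMul_injective_iff]
    intro a b hab
    by_contra hne
    refine h (a - b) (sub_ne_zero.mpr hne) ?_
    rw [Matrix.sub_vecMul, sub_eq_zero]
    exact hab
  unfold ParityPair.FullRank
  rw [hli.rank_matrix]
  simp

open Classical in
-- A rank-deficient stack has a nonzero left kernel vector `u`, and each such `u` kills a fraction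
-- `2 ^ (-n)` of all stacks. Leaving out `u = 0` gives the `- 1`, which secures full-rank matrices
-- even when `m₁ + m₂ = n`.
theorem card_not_fullRank_mul_le :
    (Finset.univ.filter fun K : ParityPair n m₁ m₂ => ¬ K.FullRank).card * 2 ^ n ≤
      (2 ^ (m₁ + m₂) - 1) * Fintype.card (ParityPair n m₁ m₂) := by
  have hsub : (Finset.univ.filter fun K : ParityPair n m₁ m₂ => ¬ K.FullRank) ⊆
      (Finset.univ.erase (0 : Fin m₁ ⊕ Fin m₂ → ZMod 2)).biUnion fun u =>
        Finset.univ.filter fun K : ParityPair n m₁ m₂ => Matrix.vecMul u K.stack = 0 := by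
    intro K hK
    obtain ⟨u, hu, hu0⟩ := exists_vecMul_eq_zero_of_not_fullRank (Finset.mem_filter.mp hK).2
    simp only [mem_biUnion, mem_erase, mem_univ, and_true, mem_filter, true_and]
    exact ⟨u, hu, hu0⟩
  calc _ ≤ (∑ u ∈ Finset.univ.erase (0 : Fin m₁ ⊕ Fin m₂ → ZMod 2),
        (Finset.univ.filter fun K : ParityPair n m₁ m₂ => Matrix.vecMul u K.stack = 0).card) *
          2 ^ n := Nat.mul_le_mul_right _ ((Finset.card_le_card hsub).trans Finset.card_biUnion_le)
    _ = ∑ u ∈ Finset.univ.erase (0 : Fin m₁ ⊕ Fin m₂ → ZMod 2),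
        Fintype.card (ParityPair n m₁ m₂) := by
      rw [Finset.sum_mul]
      exact Finset.sum_congr rfl fun u hu => card_vecMul_stack_eq_zero (Finset.ne_of_mem_erase hu)
    _ = _ := by
      rw [Finset.sum_const, Finset.card_erase_of_mem (Finset.mem_univ _)]
      simp

theorem ncard_fullRank [DecidablePred fun K : ParityPair n m₁ m₂ => K.FullRank] :
    {K : ParityPair n m₁ m₂ | K.FullRank}.ncard =
      (Finset.univ.filter fun K : ParityPair n m₁ m₂ => K.FullRank).card := by
  rw [← Set.ncard_coe_finset]
  simp

theorem ncard_fullRank_pos (h : m₁ + m₂ ≤ n) :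
    0 < {K : ParityPair n m₁ m₂ | K.FullRank}.ncard := by
  classical
  rw [ncard_fullRank]
  have h1 := card_not_fullRank_mul_le (n := n) (m₁ := m₁) (m₂ := m₂)
  have h2 := Finset.card_filter_add_card_filter_not (s := Finset.univ)
    (fun K : ParityPair n m₁ m₂ => K.FullRank)
  rw [Finset.card_univ] at h2
  have hN : 0 < Fintype.card (ParityPair n m₁ m₂) := Fintype.card_pos
  by_contra h0
  rw [not_lt, Nat.le_zero] at h0
  rw [h0, zero_add] at h2
  rw [h2, mul_comm] at h1
  have h3 := Nat.le_of_mul_le_mul_right h1 hN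
  have h4 : 2 ^ (m₁ + m₂) ≤ 2 ^ n := Nat.pow_le_pow_right two_pos h
  have h5 : 0 < 2 ^ (m₁ + m₂) := by positivity
  omega

theorem card_le_two_mul_ncard_fullRank (h : m₁ + m₂ < n) :
    Fintype.card (ParityPair n m₁ m₂) ≤ 2 * {K : ParityPair n m₁ m₂ | K.FullRank}.ncard := by
  classical
  rw [ncard_fullRank]
  have h1 := card_not_fullRank_mul_le (n := n) (m₁ := m₁) (m₂ := m₂)
  have h2 := Finset.card_filter_add_card_filter_not (s := Finset.univ)
    (fun K : ParityPair n m₁ m₂ => K.FullRank)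
  rw [Finset.card_univ] at h2
  set N := Fintype.card (ParityPair n m₁ m₂)
  set b := (Finset.univ.filter fun K : ParityPair n m₁ m₂ => ¬ K.FullRank).card
  have h4 : 2 ^ (m₁ + m₂) * 2 ≤ 2 ^ n := by
    rw [← pow_succ]; exact Nat.pow_le_pow_right two_pos h
  have h5 : 0 < 2 ^ (m₁ + m₂) := by positivity
  have h6 : (b * 2) * 2 ^ (m₁ + m₂) ≤ N * 2 ^ (m₁ + m₂) := by
    calc (b * 2) * 2 ^ (m₁ + m₂) = b * (2 ^ (m₁ + m₂) * 2) := by ring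
      _ ≤ b * 2 ^ n := Nat.mul_le_mul_left _ h4
      _ ≤ _ := h1
      _ ≤ 2 ^ (m₁ + m₂) * N := Nat.mul_le_mul_right _ (Nat.sub_le _ _)
      _ = _ := mul_comm _ _
  have := Nat.le_of_mul_le_mul_right h6 h5
  omega

theorem ParityPair.FullRank.mulVec_surjective {K : ParityPair n m₁ m₂} (hK : K.FullRank) :
    Function.Surjective K.stack.mulVec := by
  have h : LinearMap.range K.stack.mulVecLin = ⊤ := by
    apply Submodule.eq_top_of_finrank_eq
    have : Module.finrank (ZMod 2) (LinearMap.range K.stack.mulVecLin) = m₁ + m₂ := hK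
    rw [this]; simp
  exact LinearMap.range_eq_top.mp h

theorem ParityPair.FullRank.card_fst_mulVec_eq {K : ParityPair n m₁ m₂} (hK : K.FullRank)
    (s : Fin m₁ → ZMod 2) :
    (Finset.univ.filter fun x => K.1.mulVec x = s).card * 2 ^ m₁ = 2 ^ n := by
  have := card_fiber_mul_card (A := Fin n → ZMod 2) (B := Fin m₁ → ZMod 2)
    (AddMonoidHom.mk' (fun x => K.1.mulVec x) fun x y => Matrix.mulVec_add _ _ _) (fun w => by
      obtain ⟨x, hx⟩ := hK.mulVec_surjective (Sum.elim w 0)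
      refine ⟨x, ?_⟩
      ext i
      have := congrFun hx (Sum.inl i)
      simpa [ParityPair.stack, Matrix.fromRows_mulVec] using this) s
  rwa [card_syndrome, card_syndrome] at this

/-- The number of syndromes with respect to `H₁` that no word of `B` has. -/
def missed (K : ParityPair n m₁ m₂) (B : Finset (Fin n → ZMod 2)) : ℕ :=
  (Finset.univ.filter fun s => ∀ e ∈ B, K.1.mulVec e ≠ s).card

/-- The number of words of `B` that differ from `v` but share its syndrome. -/
def confusions (K : ParityPair n m₁ m₂) (B : Finset (Fin n → ZMod 2)) (v : Fin n → ZMod 2) : ℕ :=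
  (B.filter fun e => e ≠ v ∧ K.stack.mulVec e = K.stack.mulVec v).card

/-- Distinct words collide under a random `H₁` with probability exactly `2 ^ (-m₁)`. In the second
moment the off-diagonal pairs therefore cancel against the squared mean, and only the diagonal of
size `|B|` remains. -/
theorem sum_missed_le (B : Finset (Fin n → ZMod 2)) (hB : B.Nonempty) :
    ∑ K : ParityPair n m₁ m₂, (missed K B : ℝ) ≤
      Fintype.card (ParityPair n m₁ m₂) * ((2 : ℝ) ^ m₁ * (2 ^ m₁ / B.card)) := by
  set N : ℝ := (Fintype.card (ParityPair n m₁ m₂) : ℝ) with hN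
  have hb : (0 : ℝ) < B.card := Nat.cast_pos.mpr hB.card_pos
  have h1 : ∀ K : ParityPair n m₁ m₂, (missed K B : ℝ) * ((B.card : ℝ) / 2 ^ m₁) ^ 2 ≤
      (((B ×ˢ B).filter fun x => K.1.mulVec x.1 = K.1.mulVec x.2).card : ℝ) -
        (B.card : ℝ) ^ 2 / 2 ^ m₁ := fun K => by
    have := card_missed_mul_le B fun e => K.1.mulVec e
    rw [card_syndrome] at this
    push_cast at this
    convert this
    unfold missed
    congr!
  have h2 : ∑ K : ParityPair n m₁ m₂,
      (((B ×ˢ B).filter fun x => K.1.mulVec x.1 = K.1.mulVec x.2).card : ℝ) ≤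
        N * B.card + (B.card : ℝ) ^ 2 * (N / 2 ^ m₁) := by
    have e1 : ∑ K : ParityPair n m₁ m₂,
        (((B ×ˢ B).filter fun x => K.1.mulVec x.1 = K.1.mulVec x.2).card : ℝ) =
        ∑ x ∈ B ×ˢ B, ((Finset.univ.filter fun K : ParityPair n m₁ m₂ =>
          K.1.mulVec x.1 = K.1.mulVec x.2).card : ℝ) := by
      simp only [Finset.card_filter, Nat.cast_sum]
      exact Finset.sum_comm
    have e2 : ∀ x : (Fin n → ZMod 2) × (Fin n → ZMod 2),
        ((Finset.univ.filter fun K : ParityPair n m₁ m₂ =>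
          K.1.mulVec x.1 = K.1.mulVec x.2).card : ℝ) ≤
        (if x.1 = x.2 then N else 0) + N / 2 ^ m₁ := by
      intro x
      split_ifs with hx
      · have : ((Finset.univ.filter fun K : ParityPair n m₁ m₂ =>
          K.1.mulVec x.1 = K.1.mulVec x.2).card : ℝ) ≤ N := by
          rw [hN]; exact_mod_cast Finset.card_le_univ _
        have : 0 ≤ N / 2 ^ m₁ := by positivity
        linarith
      · rw [zero_add, le_div_iff₀ (by positivity), hN,
          ← card_fst_mulVec_eq_zero (sub_ne_zero.mpr hx)]
        push_cast
        simp [Matrix.mulVec_sub, sub_eq_zero]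
    rw [e1]
    refine (Finset.sum_le_sum fun x _ => e2 x).trans (le_of_eq ?_)
    rw [Finset.sum_add_distrib, Finset.sum_product]
    simp only [sum_ite_eq, sum_const, card_product, nsmul_eq_mul, Nat.cast_mul]
    rw [Finset.sum_congr rfl fun x hx => if_pos hx]
    simp only [sum_const, nsmul_eq_mul]
    ring
  have h3 : (∑ K : ParityPair n m₁ m₂, (missed K B : ℝ)) * ((B.card : ℝ) / 2 ^ m₁) ^ 2 ≤
      N * B.card := by
    rw [Finset.sum_mul]
    refine (Finset.sum_le_sum fun K _ => h1 K).trans ?_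
    rw [Finset.sum_sub_distrib]
    simp only [sum_const, card_univ, nsmul_eq_mul]
    rw [← hN]
    have : N * ((B.card : ℝ) ^ 2 / 2 ^ m₁) = (B.card : ℝ) ^ 2 * (N / 2 ^ m₁) := by ring
    linarith
  rw [← le_div_iff₀ (by positivity)] at h3
  refine h3.trans (le_of_eq ?_)
  field_simp

theorem sum_confusions_le (B : Finset (Fin n → ZMod 2)) (v : Fin n → ZMod 2) :
    ∑ K : ParityPair n m₁ m₂, (confusions K B v : ℝ) ≤
      Fintype.card (ParityPair n m₁ m₂) * ((B.card : ℝ) / 2 ^ (m₁ + m₂)) := by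
  set N : ℝ := (Fintype.card (ParityPair n m₁ m₂) : ℝ) with hN
  have e1 : ∑ K : ParityPair n m₁ m₂, (confusions K B v : ℝ) =
      ∑ e ∈ B, ((Finset.univ.filter fun K : ParityPair n m₁ m₂ =>
        e ≠ v ∧ K.stack.mulVec e = K.stack.mulVec v).card : ℝ) := by
    simp only [confusions, Finset.card_filter, Nat.cast_sum]
    exact Finset.sum_comm
  rw [e1]
  have e2 : ∀ e ∈ B, ((Finset.univ.filter fun K : ParityPair n m₁ m₂ =>
        e ≠ v ∧ K.stack.mulVec e = K.stack.mulVec v).card : ℝ) ≤ N / 2 ^ (m₁ + m₂) := by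
    intro e _
    by_cases h : e = v
    · simp [h]; positivity
    · rw [le_div_iff₀ (by positivity), hN, ← card_stack_mulVec_eq_zero (sub_ne_zero.mpr h)]
      push_cast
      simp [Matrix.mulVec_sub, sub_eq_zero, h]
  refine (Finset.sum_le_sum e2).trans (le_of_eq ?_)
  simp only [sum_const, nsmul_eq_mul]
  ring

theorem sum_sum_noise_mul_confusions_le {p : ℝ} (h0 : 0 ≤ p) (h1 : p ≤ 1)
    (B B' : Finset (Fin n → ZMod 2)) :
    ∑ K : ParityPair n m₁ m₂, ∑ e ∈ B, ∑ z, noise p z * (confusions K B' (e + z) : ℝ) ≤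
      Fintype.card (ParityPair n m₁ m₂) * ((B.card : ℝ) * B'.card / 2 ^ (m₁ + m₂)) := by
  rw [Finset.sum_comm]
  have : ∀ e ∈ B, ∑ K : ParityPair n m₁ m₂, ∑ z, noise p z * (confusions K B' (e + z) : ℝ) ≤
      Fintype.card (ParityPair n m₁ m₂) * ((B'.card : ℝ) / 2 ^ (m₁ + m₂)) := by
    intro e _
    rw [Finset.sum_comm]
    calc _ ≤ ∑ z : Fin n → ZMod 2, noise p z *
          (Fintype.card (ParityPair n m₁ m₂) * ((B'.card : ℝ) / 2 ^ (m₁ + m₂))) := by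
          refine Finset.sum_le_sum fun z _ => ?_
          rw [← Finset.mul_sum]
          exact mul_le_mul_of_nonneg_left (sum_confusions_le B' _) (noise_nonneg h0 h1 z)
      _ = _ := by rw [← Finset.sum_mul, sum_noise, one_mul]
  refine (Finset.sum_le_sum this).trans (le_of_eq ?_)
  simp only [sum_const, nsmul_eq_mul]
  ring

end Matrices

end KeyAgreement

namespace KeyAgreement

open Finset

/-! ### The binary source as a uniform input plus independent noise -/

section Source

variable {n : ℕ} {p : ℝ}

theorem pi_add_self {ι : Type*} (x : ι → ZMod 2) : x + x = 0 := by
  ext i; exact CharTwo.add_self_eq_zero (x i)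

theorem pi_neg_eq {ι : Type*} (x : ι → ZMod 2) : -x = x := by
  ext i; exact CharTwo.neg_eq (x i)

theorem pi_add_cancel_left {ι : Type*} (x y : ι → ZMod 2) : x + (x + y) = y := by
  rw [← add_assoc, pi_add_self, zero_add]

theorem jointPMF_add (x z : Fin n → ZMod 2) :
    jointPMF n unifBit (bsc p) (x, x + z) = (1 / 2) ^ n * noise p z := by
  unfold jointPMF noise unifBit
  rw [Finset.prod_mul_distrib]
  simp [bsc]

theorem jointPMF_nonneg (h0 : 0 ≤ p) (h1 : p ≤ 1) (ω : (Fin n → ZMod 2) × (Fin n → ZMod 2)) :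
    0 ≤ jointPMF n unifBit (bsc p) ω :=
  Finset.prod_nonneg fun _ _ => mul_nonneg (by norm_num [unifBit]) (bsc_nonneg h0 h1 _ _)

theorem sum_jointPMF_filter (E : (Fin n → ZMod 2) × (Fin n → ZMod 2) → Prop) [DecidablePred E] :
    ∑ ω with E ω, jointPMF n unifBit (bsc p) ω =
      (1 / 2) ^ n * ∑ x, ∑ z with E (x, x + z), noise p z := by
  rw [Finset.sum_filter, Fintype.sum_prod_type, Finset.mul_sum]
  refine Finset.sum_congr rfl fun x _ => ?_
  rw [Finset.sum_filter, Finset.mul_sum, ← Equiv.sum_comp (Equiv.addLeft x)]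
  refine Finset.sum_congr rfl fun z _ => ?_
  simp only [Equiv.coe_addLeft, jointPMF_add]
  split_ifs <;> simp

theorem sum_jointPMF_filter_fst (T : (Fin n → ZMod 2) → Prop) [DecidablePred T] :
    ∑ ω with T ω.1, jointPMF n unifBit (bsc p) ω =
      (1 / 2) ^ n * ((Finset.univ.filter T).card : ℝ) := by
  rw [sum_jointPMF_filter fun ω => T ω.1, Finset.card_filter]
  push_cast
  congr 1
  refine Finset.sum_congr rfl fun x _ => ?_
  by_cases h : T x <;> simp [h, sum_noise]

theorem sum_jointPMF : ∑ ω, jointPMF n unifBit (bsc p) ω = 1 := by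
  have := sum_jointPMF_filter_fst (n := n) (p := p) fun _ => True
  simpa [← mul_pow] using this

end Source

/-! ### The construction for fixed parity-check matrices -/

namespace WZScheme

variable {n m₁ m₂ : ℕ} {p t κ : ℝ} {K : ParityPair n m₁ m₂}

theorem stack_mulVec (K : ParityPair n m₁ m₂) (x : Fin n → ZMod 2) :
    K.stack.mulVec x = Sum.elim (K.1.mulVec x) (K.2.mulVec x) :=
  Matrix.fromRows_mulVec _ _ _

/-- The word plus its coset leader lies in `C`, hence in the range of `G`. Thus key and helper data
recover the quantized word. -/
theorem vecMul_demap_add_leader (A : WZScheme K) {x : Fin n → ZMod 2} (hx : K.1.mulVec x = 0) :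
    Matrix.vecMul (A.demap x) A.G + A.leader (K.2.mulVec x) = x := by
  have hC : K.stack.mulVec (x + A.leader (K.2.mulVec x)) = 0 := by
    rw [stack_mulVec, Matrix.mulVec_add, Matrix.mulVec_add, A.leader_mem, A.leader_coset, hx,
      pi_add_self, pi_add_self]
    ext i
    rcases i with i | i <;> simp
  have h : Matrix.vecMul (A.demap x) A.G = x + A.leader (K.2.mulVec x) :=
    Function.invFun_eq (f := fun s => Matrix.vecMul s A.G) ((A.G_range _).mpr hC)
  rw [h, add_assoc, pi_add_self, add_zero]

/-- The word `x + e` is a codeword of `C₁`, so the quantizer does at least as well as it.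
Quantization quality thus depends only on the `H₁`-syndrome of the input. -/
theorem hammingNorm_add_vq_le (A : WZScheme K) (x e : Fin n → ZMod 2)
    (he : K.1.mulVec e = K.1.mulVec x) : hammingNorm (x + A.vq x) ≤ hammingNorm e := by
  have hc : K.1.mulVec (x + e) = 0 := by rw [Matrix.mulVec_add, he, pi_add_self]
  have := A.vq_min x (x + e) hc
  rwa [hammingDist_eq_hammingNorm, hammingDist_eq_hammingNorm, pi_neg_eq,
    pi_add_cancel_left] at this

/-- The input is quantized to within relative distance `t`. -/
def Covered (A : WZScheme K) (t : ℝ) (x : Fin n → ZMod 2) : Prop :=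
  (hammingNorm (x + A.vq x) : ℝ) ≤ n * t

open Classical in
theorem card_not_covered_le (hK : K.FullRank) (A : WZScheme K) :
    (1 / 2 : ℝ) ^ n * ((Finset.univ.filter fun x => ¬ A.Covered t x).card : ℝ) ≤
      missed K (ball n t) / 2 ^ m₁ := by
  set S := Finset.univ.filter fun s : Fin m₁ → ZMod 2 => ∀ e ∈ ball n t, K.1.mulVec e ≠ s with hS
  have hsub : (Finset.univ.filter fun x => ¬ A.Covered t x) ⊆
      S.biUnion fun s => Finset.univ.filter fun x => K.1.mulVec x = s := by
    intro x hx
    simp only [hS, mem_biUnion, mem_filter, mem_univ, true_and, exists_eq_right']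
    intro e he heq
    refine (Finset.mem_filter.mp hx).2 ?_
    have := A.hammingNorm_add_vq_le x e heq
    rw [mem_ball] at he
    exact le_trans (by exact_mod_cast this) he
  have h1 := (Finset.card_le_card hsub).trans Finset.card_biUnion_le
  have h2 := Nat.mul_le_mul_right (2 ^ m₁) h1
  rw [Finset.sum_mul, Finset.sum_congr rfl fun s _ => hK.card_fst_mulVec_eq s, Finset.sum_const,
    smul_eq_mul] at h2
  have hSm : S.card = missed K (ball n t) := by
    unfold missed; rw [hS]
  rw [hSm] at h2
  rw [le_div_iff₀ (by positivity), one_div, inv_pow, mul_assoc, inv_mul_le_iff₀ (by positivity),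
    mul_comm ((2 : ℝ) ^ n)]
  exact_mod_cast h2

open Classical in
theorem one_sub_le_sum_covered (hK : K.FullRank) (A : WZScheme K) :
    1 - missed K (ball n t) / 2 ^ m₁ ≤
      ∑ ω with A.Covered t ω.1, jointPMF n unifBit (bsc p) ω := by
  have h1 := A.card_not_covered_le (t := t) hK
  have h2 := Finset.card_filter_add_card_filter_not (s := Finset.univ) (A.Covered t)
  rw [Finset.card_univ, card_syndrome] at h2
  have h3 : (1 / 2 : ℝ) ^ n * ((Finset.univ.filter (A.Covered t)).card : ℝ) +
      (1 / 2 : ℝ) ^ n * ((Finset.univ.filter fun x => ¬ A.Covered t x).card : ℝ) = 1 := by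
    rw [← mul_add, ← Nat.cast_add, h2]
    push_cast
    rw [← mul_pow]
    norm_num
  rw [sum_jointPMF_filter_fst (A.Covered t)]
  linarith

/-- The key and the helper data determine the quantized word, so that their joint entropy is
limited only by the number of inputs that are quantized to the same word. -/
theorem le_entropy_key_helper (h0 : 0 ≤ p) (h1 : p ≤ 1) (hK : K.FullRank) (A : WZScheme K) {c : ℝ}
    (hc : 0 ≤ c) (hball : ((ball n t).card : ℝ) ≤ Real.exp (n * Real.log 2 - c)) :
    (1 - missed K (ball n t) / 2 ^ m₁) * c - missed K (ball n t) / 2 ^ m₁ ≤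
      entropy (jointPMF n unifBit (bsc p))
        (fun ω => ((A.toGSCode.enc ω.1).1, (A.toGSCode.enc ω.1).2)) * Real.log 2 := by
  classical
  have hcov := A.one_sub_le_sum_covered (t := t) (p := p) hK
  have := le_entropy_of_fiber_le (jointPMF_nonneg (n := n) h0 h1) sum_jointPMF
    (fun ω => ((A.toGSCode.enc ω.1).1, (A.toGSCode.enc ω.1).2)) (fun ω => A.Covered t ω.1) c ?_
  · nlinarith
  · rintro ⟨s, w⟩
    rw [sum_jointPMF_filter_fst fun x =>
      ((A.toGSCode.enc x).1, (A.toGSCode.enc x).2) = (s, w) ∧ A.Covered t x]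
    set a := Matrix.vecMul s A.G + A.leader w with ha
    have hcard : (Finset.univ.filter fun x =>
        ((A.toGSCode.enc x).1, (A.toGSCode.enc x).2) = (s, w) ∧ A.Covered t x).card ≤
        (ball n t).card := by
      refine Finset.card_le_card_of_injOn (fun x => x + a) ?_ fun x _ y _ h => add_right_cancel h
      intro x hx
      simp only [coe_filter, mem_univ, true_and, Set.mem_ofPred_eq, Prod.mk.injEq, toGSCode] at hx
      have hvq := A.vecMul_demap_add_leader (A.vq_mem x)
      rw [hx.1.1, hx.1.2] at hvq
      rw [Finset.mem_coe, mem_ball, ha, hvq]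
      exact hx.2
    have h2 : (1 / 2 : ℝ) ^ n = Real.exp (-(n * Real.log 2)) := by
      rw [Real.exp_neg, Real.exp_nat_mul, Real.exp_log two_pos, one_div, inv_pow]
    have h3 : Real.exp (-c) = (1 / 2 : ℝ) ^ n * Real.exp (n * Real.log 2 - c) := by
      rw [h2, ← Real.exp_add]; congr 1; ring
    rw [h3]
    refine mul_le_mul_of_nonneg_left (le_trans ?_ hball) (by positivity)
    exact_mod_cast hcard

/-- If the decoder fails then some other word of the same syndrome is no heavier than the error
word that it looks for. -/
theorem exists_confusion_of_key_ne (A : WZScheme K) (x z : Fin n → ZMod 2)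
    (h : A.toGSCode.dec (x + z) (A.toGSCode.enc x).2 ≠ (A.toGSCode.enc x).1) :
    ∃ e, e ≠ x + A.vq x + z ∧ K.stack.mulVec e = K.stack.mulVec (x + A.vq x + z) ∧
      hammingNorm e ≤ hammingNorm (x + A.vq x + z) := by
  set σ := Sum.elim (0 : Fin m₁ → ZMod 2) (K.2.mulVec (A.vq x)) + K.stack.mulVec (x + z) with hσ
  have hs : σ = K.stack.mulVec (x + A.vq x + z) := by
    have : Sum.elim (0 : Fin m₁ → ZMod 2) (K.2.mulVec (A.vq x)) = K.stack.mulVec (A.vq x) := by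
      rw [stack_mulVec, A.vq_mem]
    rw [hσ, this, ← Matrix.mulVec_add]
    congr 1
    abel
  refine ⟨A.synDec σ, ?_, by rw [A.synDec_syndrome, hs], A.synDec_min _ _ hs.symm⟩
  intro heq
  apply h
  show A.demap (x + z + A.synDec σ) = A.demap (A.vq x)
  rw [heq]
  congr 1
  rw [show x + z + (x + A.vq x + z) = (x + x) + (z + z) + A.vq x by abel, pi_add_self, pi_add_self,
    zero_add, zero_add]

open Classical in
-- The three terms account for badly quantized inputs, noise that carries the error word out of the
-- larger ball, and confusions inside that ball. The quantization error need not be uniform on the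
-- ball; the last term only uses that no error word is produced too often.
theorem sum_key_ne_le (h0 : 0 ≤ p) (h1 : p ≤ 1 / 2) (hκ0 : 0 ≤ κ) (hκ1 : κ ≤ 1) (hK : K.FullRank)
    (A : WZScheme K) :
    (∑ ω with A.toGSCode.dec ω.2 (A.toGSCode.enc ω.1).2 ≠ (A.toGSCode.enc ω.1).1,
      jointPMF n unifBit (bsc p) ω) ≤
      missed K (ball n t) / 2 ^ m₁ + Real.exp (-(n * κ ^ 2 / 4)) +
      (∑ e ∈ ball n t, ∑ z, noise p z * (confusions K (ball n (conv t p + κ)) (e + z) : ℝ)) /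
        2 ^ m₁ := by
  set r := conv t p + κ with hr
  set F : (Fin n → ZMod 2) → ℝ := fun e => ∑ z, noise p z * (confusions K (ball n r) (e + z) : ℝ)
    with hF
  have hn0 := noise_nonneg (n := n) h0 (show p ≤ 1 by linarith)
  have hF0 : ∀ e, 0 ≤ F e := fun e =>
    Finset.sum_nonneg fun z _ => mul_nonneg (hn0 z) (Nat.cast_nonneg _)
  have hpt : ∀ x, (∑ z with A.toGSCode.dec (x + z) (A.toGSCode.enc x).2 ≠ (A.toGSCode.enc x).1,
      noise p z) ≤ (if ¬ A.Covered t x then 1 else 0) + Real.exp (-(n * κ ^ 2 / 4)) +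
        (if A.Covered t x then F (x + A.vq x) else 0) := by
    intro x
    by_cases hx : A.Covered t x
    · simp only [hx, not_true_eq_false, if_false, if_true, zero_add]
      refine le_trans ?_ (add_le_add_left
        (sum_noise_weight_add_gt (t := t) h0 h1 hκ0 hκ1 (x + A.vq x) hx) _)
      rw [Finset.sum_filter, Finset.sum_filter, hF, ← Finset.sum_add_distrib]
      refine Finset.sum_le_sum fun z _ => ?_
      have hz := hn0 z
      have hconf : 0 ≤ noise p z * (confusions K (ball n r) (x + A.vq x + z) : ℝ) :=
        mul_nonneg hz (Nat.cast_nonneg _)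
      by_cases hw : (hammingNorm (x + A.vq x + z) : ℝ) ≤ n * r
      · rw [if_neg (not_not.mpr hw), zero_add]
        split_ifs with hd
        · obtain ⟨e, he1, he2, he3⟩ := A.exists_confusion_of_key_ne x z hd
          have hpos : 0 < confusions K (ball n r) (x + A.vq x + z) := by
            refine Finset.card_pos.mpr ⟨e, Finset.mem_filter.mpr ⟨mem_ball.mpr ?_, he1, he2⟩⟩
            exact le_trans (by exact_mod_cast he3) hw
          have : (1 : ℝ) ≤ confusions K (ball n r) (x + A.vq x + z) := by exact_mod_cast hpos
          nlinarith
        · exact hconf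
      · rw [if_pos hw]
        split_ifs <;> linarith
    · simp only [hx, not_false_eq_true, if_true, if_false, add_zero]
      have h3 : (∑ z with A.toGSCode.dec (x + z) (A.toGSCode.enc x).2 ≠ (A.toGSCode.enc x).1,
          noise p z) ≤ 1 := by
        rw [← sum_noise (n := n) p]
        exact Finset.sum_le_sum_of_subset_of_nonneg (Finset.filter_subset _ _) fun z _ _ => hn0 z
      linarith [Real.exp_pos (-(n * κ ^ 2 / 4))]
  -- Inputs with quantization error `e` all have the `H₁`-syndrome of `e`, so there are at most `2 ^
  -- (n - m₁)` of them.
  have hcov : ∑ x, (if A.Covered t x then F (x + A.vq x) else 0) ≤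
      ∑ e ∈ ball n t, F e * ((2 : ℝ) ^ n / 2 ^ m₁) := by
    have hmaps : ∀ x ∈ Finset.univ.filter (A.Covered t), x + A.vq x ∈ ball n t := fun x hx =>
      mem_ball.mpr (Finset.mem_filter.mp hx).2
    rw [← Finset.sum_filter, ← Finset.sum_fiberwise_of_maps_to hmaps]
    refine Finset.sum_le_sum fun e _ => ?_
    rw [Finset.sum_congr rfl fun x hx => by rw [(Finset.mem_filter.mp hx).2], Finset.sum_const,
      nsmul_eq_mul, mul_comm]
    refine mul_le_mul_of_nonneg_left ?_ (hF0 e)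
    rw [le_div_iff₀ (by positivity)]
    have hcard := hK.card_fst_mulVec_eq (K.1.mulVec e)
    have hle : (((Finset.univ.filter (A.Covered t)).filter fun x => x + A.vq x = e).card) ≤
        (Finset.univ.filter fun x => K.1.mulVec x = K.1.mulVec e).card := by
      refine Finset.card_le_card fun x hx => ?_
      simp only [mem_filter, mem_univ, true_and] at hx ⊢
      rw [← hx.2, Matrix.mulVec_add, A.vq_mem, add_zero]
    have := Nat.mul_le_mul_right (2 ^ m₁) hle
    rw [hcard] at this
    exact_mod_cast this
  rw [sum_jointPMF_filter fun ω => A.toGSCode.dec ω.2 (A.toGSCode.enc ω.1).2 ≠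
    (A.toGSCode.enc ω.1).1]
  have h2n : (1 / 2 : ℝ) ^ n * 2 ^ n = 1 := by rw [← mul_pow]; norm_num
  calc _ ≤ (1 / 2 : ℝ) ^ n * ∑ x, ((if ¬ A.Covered t x then (1 : ℝ) else 0) +
        Real.exp (-(n * κ ^ 2 / 4)) + (if A.Covered t x then F (x + A.vq x) else 0)) :=
        mul_le_mul_of_nonneg_left (Finset.sum_le_sum fun x _ => hpt x) (by positivity)
    _ = (1 / 2 : ℝ) ^ n * ((Finset.univ.filter fun x => ¬ A.Covered t x).card : ℝ) +
        Real.exp (-(n * κ ^ 2 / 4)) +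
        (1 / 2 : ℝ) ^ n * ∑ x, (if A.Covered t x then F (x + A.vq x) else 0) := by
      rw [Finset.sum_add_distrib, Finset.sum_add_distrib, Finset.sum_boole, Finset.sum_const,
        Finset.card_univ, card_syndrome, nsmul_eq_mul]
      push_cast
      linear_combination (Real.exp (-(n * κ ^ 2 / 4))) * h2n
    _ ≤ _ := by
      refine add_le_add (add_le_add_left (A.card_not_covered_le hK) _) ?_
      refine (mul_le_mul_of_nonneg_left hcov (by positivity)).trans (le_of_eq ?_)
      rw [← Finset.sum_mul]
      calc _ = ((1 / 2 : ℝ) ^ n * 2 ^ n) * ((∑ e ∈ ball n t, F e) / 2 ^ m₁) := by ring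
        _ = _ := by rw [h2n, one_mul]

/-- For parity-check matrices under which few words are missed by the quantizer and few words are
confused by the decoder, the code meets all the constraints. -/
theorem satisfies_of_missed_le (h0 : 0 ≤ p) (h1 : p ≤ 1 / 2) (hκ0 : 0 ≤ κ) (hκ1 : κ ≤ 1)
    (hn : 1 ≤ n) (hm : m₁ + m₂ ≤ n)
    (hK : K.FullRank) (A : WZScheme K) {c η Rs Rl Rw ε : ℝ} (hc : 0 ≤ c) (hcn : c ≤ n * Real.log 2)
    (hball : ((ball n t).card : ℝ) ≤ Real.exp (n * Real.log 2 - c))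
    (hη : missed K (ball n t) / 2 ^ m₁ ≤ η)
    (hη' : (∑ e ∈ ball n t, ∑ z, noise p z * (confusions K (ball n (conv t p + κ)) (e + z) : ℝ)) /
        2 ^ m₁ ≤ η)
    (hRs : Rs = ((n : ℝ) - m₁ - m₂) / n)
    (herr : η + Real.exp (-(n * κ ^ 2 / 4)) + η ≤ ε)
    (hsec : ((n : ℝ) - m₁) * Real.log 2 - c + η * (n * Real.log 2) + η ≤ ε * n * Real.log 2)
    (hw : (m₂ : ℝ) / n ≤ Rw + ε) (hl : (m₂ : ℝ) / n ≤ Rl + ε) :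
    A.toGSCode.Satisfies unifBit (bsc p) Rs Rl Rw ε := by
  classical
  have hP := jointPMF_nonneg (n := n) h0 (show p ≤ 1 by linarith)
  have hP1 := sum_jointPMF (n := n) (p := p)
  have hlog := Real.log_pos one_lt_two
  have hn0 : (0 : ℝ) < n := by exact_mod_cast hn
  have hS : Real.logb 2 (Fintype.card (Fin (n - (m₁ + m₂)) → ZMod 2) : ℕ) = n - m₁ - m₂ := by
    rw [card_syndrome]
    push_cast
    rw [Real.logb_pow, Real.logb_self_eq_one one_lt_two, Nat.cast_sub hm]
    push_cast
    ring
  have hW : Real.logb 2 (Fintype.card (Fin m₂ → ZMod 2) : ℕ) = m₂ := by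
    rw [card_syndrome]
    push_cast
    rw [Real.logb_pow, Real.logb_self_eq_one one_lt_two, mul_one]
  -- Both secrecy and key uniformity come from this single bound, once the marginal entropies are
  -- bounded by the alphabet sizes.
  have hpair : ((n : ℝ) - m₁) - ε * n ≤ entropy (jointPMF n unifBit (bsc p))
        (fun ω => ((A.toGSCode.enc ω.1).1, (A.toGSCode.enc ω.1).2)) := by
    have := A.le_entropy_key_helper h0 (show p ≤ 1 by linarith) hK hc hball
    rw [← mul_le_mul_iff_left₀ hlog]
    have hu0 : 0 ≤ (missed K (ball n t) : ℝ) / 2 ^ m₁ := by positivity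
    nlinarith
  have hkey := entropy_le_logb_card hP hP1 (fun ω => (A.toGSCode.enc ω.1).1)
  have hhelp := entropy_le_logb_card hP hP1 (fun ω => (A.toGSCode.enc ω.1).2)
  have hsub := mutualInfo_nonneg hP hP1 (fun ω => (A.toGSCode.enc ω.1).1)
    (fun ω => (A.toGSCode.enc ω.1).2)
  unfold mutualInfo at hsub
  rw [hS] at hkey
  rw [hW] at hhelp
  refine ⟨?_, ?_, ?_, ?_, ?_, ?_⟩
  · rw [hS, hRs]
  · refine le_trans ?_ herr
    have := A.sum_key_ne_le (t := t) (κ := κ) h0 h1 hκ0 hκ1 hK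
    have h3 := this.trans (add_le_add (add_le_add_left hη _) hη')
    convert h3
  · rw [div_le_iff₀ hn0]
    unfold mutualInfo
    linarith
  · rw [ge_iff_le, le_div_iff₀ hn0, hRs, sub_mul, div_mul_cancel₀ _ hn0.ne']
    linarith
  · rw [hW]; exact hw
  · refine le_trans (div_le_div_of_nonneg_right ?_ hn0.le) hl
    rw [← hW]
    exact mutualInfo_apply_le hP hP1 (fun ω => ω.1) (fun x => (A.toGSCode.enc x).2)

end WZScheme

end KeyAgreement

namespace KeyAgreement

open Finset Filter Topology

/-! ### Monotonicity of the binary rates -/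

section Entropy

theorem Hb_mul_log_two (x : ℝ) : Hb x * Real.log 2 = Real.binEntropy x :=
  div_mul_cancel₀ _ (Real.log_pos one_lt_two).ne'

theorem continuous_Hb : Continuous Hb := Real.binEntropy_continuous.div_const _

theorem Hb_half : Hb (1 / 2) = 1 := by
  unfold Hb
  rw [one_div, Real.binEntropy_two_inv, div_self (Real.log_pos one_lt_two).ne']

theorem Hb_le_one (x : ℝ) : Hb x ≤ 1 :=
  (div_le_one (Real.log_pos one_lt_two)).mpr Real.binEntropy_le_log_two

theorem Hb_nonneg {x : ℝ} (h0 : 0 ≤ x) (h1 : x ≤ 1) : 0 ≤ Hb x :=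
  div_nonneg (Real.binEntropy_nonneg h0 h1) (Real.log_nonneg one_le_two)

theorem Hb_pos {x : ℝ} (h0 : 0 < x) (h1 : x < 1) : 0 < Hb x :=
  div_pos (Real.binEntropy_pos h0 h1) (Real.log_pos one_lt_two)

theorem Hb_le_Hb {x y : ℝ} (h0 : 0 ≤ x) (hxy : x ≤ y) (hy : y ≤ 1 / 2) : Hb x ≤ Hb y := by
  refine div_le_div_of_nonneg_right ?_ (Real.log_nonneg one_le_two)
  rw [one_div] at hy
  exact Real.binEntropy_strictMonoOn.monotoneOn ⟨h0, hxy.trans hy⟩ ⟨h0.trans hxy, hy⟩ hxy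

theorem le_conv {p q : ℝ} (hp : 0 ≤ p) (hq : q ≤ 1 / 2) : q ≤ conv q p := by
  unfold conv; nlinarith

theorem conv_le_half {p q : ℝ} (hp : p ≤ 1 / 2) (hq : q ≤ 1 / 2) : conv q p ≤ 1 / 2 := by
  unfold conv; nlinarith

theorem continuous_conv_left (p : ℝ) : Continuous fun q => conv q p := by
  unfold conv; fun_prop

/-- The rate `H_b(q * p) - H_b(q)` decreases as the distortion `q` grows. -/
theorem antitoneOn_Hb_conv_sub_Hb {p : ℝ} (hp0 : 0 ≤ p) (hp1 : p ≤ 1 / 2) :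
    AntitoneOn (fun q => Hb (conv q p) - Hb q) (Set.Icc 0 (1 / 2)) := by
  have hderiv : ∀ q ∈ Set.Ioo (0 : ℝ) (1 / 2), HasDerivAt (fun q => Hb (conv q p) - Hb q)
      (((Real.log (1 - conv q p) - Real.log (conv q p)) * (1 - 2 * p)) / Real.log 2 -
        (Real.log (1 - q) - Real.log q) / Real.log 2) q := by
    intro q hq
    have hr0 : 0 < conv q p := hq.1.trans_le (le_conv hp0 hq.2.le)
    have hr1 := conv_le_half hp1 hq.2.le
    have hc : HasDerivAt (fun q => conv q p) (1 - 2 * p) q := by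
      unfold conv
      have := ((hasDerivAt_id q).mul_const (1 - p)).add
        (((hasDerivAt_id q).const_sub 1).mul_const p)
      exact this.congr_deriv (by ring)
    exact (((Real.hasDerivAt_binEntropy hr0.ne' (by linarith)).comp q hc).div_const _).sub
      ((Real.hasDerivAt_binEntropy hq.1.ne' (by linarith [hq.2])).div_const _)
  refine antitoneOn_of_deriv_nonpos (convex_Icc _ _) ?_ ?_ ?_
  · exact ((continuous_Hb.comp (continuous_conv_left p)).sub continuous_Hb).continuousOn
  · intro q hq
    rw [interior_Icc] at hq
    exact (hderiv q hq).differentiableAt.differentiableWithinAt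
  · intro q hq
    rw [interior_Icc] at hq
    rw [(hderiv q hq).deriv, ← sub_div]
    refine div_nonpos_of_nonpos_of_nonneg ?_ (Real.log_nonneg one_le_two)
    -- With `r = q * p`, the ordering `q ≤ r ≤ 1/2` gives `0 ≤ log ((1 - r) / r) ≤ log ((1 - q) /
    -- q)`, and the factor `1 - 2p` lies in `[0, 1]`.
    have h1 := le_conv hp0 hq.2.le
    have h2 := conv_le_half hp1 hq.2.le
    have h3 := hq.1.trans_le h1
    have l1 : Real.log (conv q p) ≤ Real.log (1 - conv q p) :=
      Real.log_le_log h3 (by linarith)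
    have l2 : Real.log q ≤ Real.log (conv q p) := Real.log_le_log hq.1 h1
    have l3 : Real.log (1 - conv q p) ≤ Real.log (1 - q) :=
      Real.log_le_log (by linarith) (by linarith)
    nlinarith

end Entropy

/-! ### From averages over all matrices to full-rank matrices -/

section Random

variable {n m₁ m₂ : ℕ} {p : ℝ}

/-- A union bound over the random parity-check matrices, by Markov's inequality. -/
theorem one_sub_le_successProb (hm : m₁ + m₂ < n) {Rs Rl Rw ε a η : ℝ} (hη : 0 < η)
    (f : ParityPair n m₁ m₂ → ℝ) (hf0 : ∀ K, 0 ≤ f K)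
    (hf : ∑ K, f K ≤ Fintype.card (ParityPair n m₁ m₂) * a)
    (h : ∀ K, K.FullRank → f K ≤ η →
      ∀ A : WZScheme K, A.toGSCode.Satisfies unifBit (bsc p) Rs Rl Rw ε) :
    1 - 2 * a / η ≤ successProb p n m₁ m₂ Rs Rl Rw ε := by
  classical
  unfold successProb
  have hpos := ncard_fullRank_pos (n := n) (m₁ := m₁) (m₂ := m₂) hm.le
  have htwo := card_le_two_mul_ncard_fullRank (n := n) (m₁ := m₁) (m₂ := m₂) hm
  set F : Set (ParityPair n m₁ m₂) := {K | K.FullRank}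
  set S : Set (ParityPair n m₁ m₂) := {K | K.FullRank ∧
      ∀ A : WZScheme K, A.toGSCode.Satisfies unifBit (bsc p) Rs Rl Rw ε}
  set B : Finset (ParityPair n m₁ m₂) := Finset.univ.filter fun K => η < f K with hB
  have hsub : F ⊆ S ∪ (B : Set (ParityPair n m₁ m₂)) := by
    intro K hK
    by_cases hfK : f K ≤ η
    · exact Or.inl ⟨hK, h K hK hfK⟩
    · exact Or.inr (by simpa [hB] using hfK)
  have hcard : F.ncard ≤ S.ncard + B.card := by
    refine (Set.ncard_le_ncard hsub (Set.toFinite _)).trans ((Set.ncard_union_le _ _).trans ?_)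
    rw [Set.ncard_coe_finset]
  have hmarkov : (B.card : ℝ) * η ≤ Fintype.card (ParityPair n m₁ m₂) * a := by
    rw [← nsmul_eq_mul]
    refine (Finset.card_nsmul_le_sum B f η fun K hK => (Finset.mem_filter.mp hK).2.le).trans ?_
    exact (Finset.sum_le_sum_of_subset_of_nonneg (Finset.subset_univ _)
      fun K _ _ => hf0 K).trans hf
  have hN : (0 : ℝ) < Fintype.card (ParityPair n m₁ m₂) := Nat.cast_pos.mpr Fintype.card_pos
  have ha : 0 ≤ a := by
    have : 0 ≤ Fintype.card (ParityPair n m₁ m₂) * a :=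
      (Finset.sum_nonneg fun K _ => hf0 K).trans hf
    exact nonneg_of_mul_nonneg_right this hN
  have hposR : (0 : ℝ) < F.ncard := Nat.cast_pos.mpr hpos
  have htwoR : (Fintype.card (ParityPair n m₁ m₂) : ℝ) ≤ 2 * F.ncard := by exact_mod_cast htwo
  have hcardR : (F.ncard : ℝ) ≤ S.ncard + B.card := by exact_mod_cast hcard
  rw [le_div_iff₀ hposR, sub_mul, one_mul]
  -- The factor `2` pays for conditioning on full rank.
  have hBle : (B.card : ℝ) ≤ 2 * a / η * F.ncard := by
    rw [div_mul_eq_mul_div, le_div_iff₀ hη]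
    nlinarith
  linarith

end Random

/-! ### Choice of parameters -/

section Achievability

variable {p : ℝ}

/-- With `m₁ + m₂ = n` the key is trivial and the construction achieves the key rate `0`. -/
theorem zero_mem_wzAchievable (hp0 : 0 ≤ p) (hp1 : p ≤ 1 / 2) {q Rl Rw : ℝ}
    (hq : q ∈ Set.Icc (0 : ℝ) (1 / 2)) (hr : Hb (conv q p) = 1)
    (hl : 1 - Hb q ≤ Rl) (hw : 1 - Hb q ≤ Rw) : ((0 : ℝ), Rl, Rw) ∈ wzAchievable p := by
  refine ⟨q, hq, fun ε hε => ?_⟩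
  obtain ⟨k, hk⟩ := exists_nat_gt (1 / ε)
  set n := k + 1 with hn
  have hn0 : (0 : ℝ) < n := by positivity
  have hnε : 1 / (n : ℝ) ≤ ε := by
    rw [div_le_iff₀ hn0]
    rw [div_lt_iff₀ hε] at hk
    rw [hn]; push_cast; nlinarith
  have hHq0 : 0 ≤ Hb q := Hb_nonneg hq.1 (by linarith [hq.2])
  have hHq1 := Hb_le_one q
  set m₁ := ⌊n * Hb q⌋₊ with hm₁
  have hf1 : (m₁ : ℝ) ≤ n * Hb q := Nat.floor_le (by positivity)
  have hf2 : n * Hb q < m₁ + 1 := Nat.lt_floor_add_one _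
  have hm₁n : m₁ ≤ n := by
    have : (m₁ : ℝ) ≤ n := by nlinarith
    exact_mod_cast this
  obtain ⟨m₂, hm₂⟩ := Nat.exists_eq_add_of_le hm₁n
  have hm₂R : (n : ℝ) = m₁ + m₂ := by exact_mod_cast hm₂
  -- Here `n * δ ≤ 1 / 4`, so the rounding tolerance absorbs `δ` and allows `m₁ + m₂ = n`.
  set δ : ℝ := min (1 / 2) (m₁ + 1 - n * Hb q) / (2 * n) with hδ
  have hmin : 0 < min (1 / 2 : ℝ) (m₁ + 1 - n * Hb q) := lt_min (by norm_num) (by linarith)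
  have hnδ : n * δ = min (1 / 2) (m₁ + 1 - n * Hb q) / 2 := by rw [hδ]; field_simp
  have hnδ1 := min_le_left (1 / 2 : ℝ) (m₁ + 1 - n * Hb q)
  have hnδ2 := min_le_right (1 / 2 : ℝ) (m₁ + 1 - n * Hb q)
  have hratio : (m₂ : ℝ) / n ≤ 1 - Hb q + ε := by
    have : (m₂ : ℝ) / n ≤ 1 - Hb q + 1 / n := by
      rw [div_le_iff₀ hn0, add_mul, one_div, inv_mul_cancel₀ hn0.ne']
      nlinarith
    linarith
  refine ⟨n, m₁, m₂, δ, by omega, by omega, by positivity, ?_, ?_, ?_⟩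
  · rw [abs_lt]
    constructor <;> nlinarith
  · rw [abs_lt, hr, ← hm₂R]
    constructor <;> nlinarith
  · have hall : {K : ParityPair n m₁ m₂ | K.FullRank ∧
        ∀ A : WZScheme K, A.toGSCode.Satisfies unifBit (bsc p) 0 Rl Rw ε} =
        {K : ParityPair n m₁ m₂ | K.FullRank} := by
      ext K
      simp only [Set.mem_ofPred_eq, and_iff_left_iff_imp]
      intro _ A
      have hP := jointPMF_nonneg (n := n) hp0 (show p ≤ 1 by linarith)
      have hP1 := sum_jointPMF (n := n) (p := p)
      have : IsEmpty (Fin (n - (m₁ + m₂))) := by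
        rw [show n - (m₁ + m₂) = 0 by omega]; infer_instance
      have hsub : Subsingleton (Fin (n - (m₁ + m₂)) → ZMod 2) := inferInstance
      have hW : Real.logb 2 (Fintype.card (Fin m₂ → ZMod 2) : ℕ) = m₂ := by
        rw [card_syndrome]
        push_cast
        rw [Real.logb_pow, Real.logb_self_eq_one one_lt_two, mul_one]
      refine ⟨?_, ?_, ?_, ?_, ?_, ?_⟩
      · simp [hm₂]
      · refine (Finset.sum_eq_zero fun ω hω => ?_).trans_le hε.le
        exact absurd (Subsingleton.elim _ _) ((@Finset.mem_filter _ _ (_) _ _).mp hω).2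
      · rw [mutualInfo_of_subsingleton_left hP hP1, zero_div]
        exact hε.le
      · rw [entropy_of_subsingleton hP hP1, zero_div]
        linarith
      · rw [hW]; linarith
      · have := mutualInfo_apply_le hP hP1 (fun ω => ω.1) (fun x => (A.toGSCode.enc x).2)
        rw [hW] at this
        exact (div_le_div_of_nonneg_right this hn0.le).trans (by linarith)
    unfold successProb
    simp only
    rw [hall, div_self]
    · linarith
    · exact_mod_cast (ncard_fullRank_pos (by omega)).ne'

/-- Supplies a covering radius `τ + ζ` strictly below `q`: the ball exponent exceeds the exponent
`binEntropy q - δ` of `2 ^ m₁` by `γ`, up to an error `γ / 2`. All exponents are in nats. -/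
theorem exists_distortion {q δ γ : ℝ} (hq0 : 0 < q) (hq1 : q < 1 / 2) (hγ : 0 < γ)
    (hγδ : γ < δ) (hδ : δ < Real.binEntropy q) :
    ∃ τ ζ : ℝ, 0 < τ ∧ τ ≤ 1 / 2 ∧ 0 < ζ ∧ ζ ≤ 1 ∧ τ + ζ < q ∧
      Real.binEntropy τ = Real.binEntropy q - δ + γ ∧
      ζ * Real.log ((1 - τ) / τ) ≤ γ / 2 := by
  have hmem : Real.binEntropy q - δ + γ ∈ Set.Icc (Real.binEntropy 0) (Real.binEntropy q) := by
    rw [Real.binEntropy_zero]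
    constructor <;> linarith
  obtain ⟨τ, hτ, hτe⟩ :=
    intermediate_value_Icc hq0.le Real.binEntropy_continuous.continuousOn hmem
  have hτ0 : 0 < τ := hτ.1.lt_of_ne fun h => by
    rw [← h, Real.binEntropy_zero] at hτe; linarith
  have hτq : τ < q := hτ.2.lt_of_ne fun h => by rw [h] at hτe; linarith
  have hL := log_one_sub_div_nonneg hτ0 (by linarith)
  set L := Real.log ((1 - τ) / τ)
  refine ⟨τ, min ((q - τ) / 2) (γ / (2 * (L + 1))), hτ0, by linarith,
    lt_min (by linarith) (by positivity), (min_le_left _ _).trans (by linarith), ?_, hτe, ?_⟩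
  · have := min_le_left ((q - τ) / 2) (γ / (2 * (L + 1)))
    linarith
  · calc _ ≤ γ / (2 * (L + 1)) * L := mul_le_mul_of_nonneg_right (min_le_right _ _) hL
      _ ≤ γ / 2 := by
        rw [div_mul_eq_mul_div, div_le_div_iff₀ (by positivity) two_pos]
        nlinarith

theorem eventually_exp_neg_mul_le {c d : ℝ} (hc : 0 < c) (hd : 0 < d) :
    ∀ᶠ n : ℕ in atTop, Real.exp (-(n * c)) ≤ d := by
  have h : Tendsto (fun n : ℕ => Real.exp (-(n * c))) atTop (𝓝 0) :=
    Real.tendsto_exp_neg_atTop_nhds_zero.comp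
      (tendsto_natCast_atTop_atTop.atTop_mul_const hc)
  exact h.eventually_le_const hd

theorem two_pow_eq_exp (m : ℕ) : (2 : ℝ) ^ m = Real.exp (m * Real.log 2) := by
  rw [Real.exp_nat_mul, Real.exp_log two_pos]

set_option maxHeartbeats 1000000 in
-- The key rate must be met exactly, hence a rational `a / b` and blocklengths that are multiples of
-- `b`. The `2 * δ` arises because `m₁` is reduced and `m₁ + m₂` increased by about `n δ`.
theorem mem_wzAchievable (hp0 : 0 ≤ p) (hp1 : p < 1 / 2) {q δ Rl Rw : ℝ} {a b : ℕ}
    (hq0 : 0 < q) (hq1 : q < 1 / 2) (hδ0 : 0 < δ) (hδ1 : δ < Hb q) (ha : 0 < a) (hb : 0 < b)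
    (hab : (a : ℝ) / b = 1 - Hb (conv q p) - δ)
    (hl : Hb (conv q p) - Hb q + 2 * δ ≤ Rl) (hw : Hb (conv q p) - Hb q + 2 * δ ≤ Rw) :
    ((a : ℝ) / b, Rl, Rw) ∈ wzAchievable p := by
  refine ⟨q, ⟨hq0.le, hq1.le⟩, fun ε hε => ?_⟩
  have hlog : 0 < Real.log 2 := Real.log_pos one_lt_two
  have hlog2 : 1 / 2 ≤ Real.log 2 := by linarith [Real.log_two_gt_d9]
  set r := conv q p with hr
  have hr0 : 0 < r := hq0.trans_le (le_conv hp0 hq1.le)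
  have hr1 : r ≤ 1 / 2 := conv_le_half hp1.le hq1.le
  have hHqr : Hb q ≤ Hb r := Hb_le_Hb hq0.le (le_conv hp0 hq1.le) hr1
  -- The first bound makes the packing exponent `3γ/2 - δ log 2` at most `-γ/2`; the second keeps
  -- the entropy loss `3γ/2` per symbol below `ε log 2 / 4`.
  set γ := min (δ * Real.log 2 / 2) (ε * Real.log 2 / 6) with hγ
  have hγ0 : 0 < γ := lt_min (by positivity) (by positivity)
  have hγδ : γ ≤ δ * Real.log 2 / 2 := min_le_left _ _
  have hγε : γ ≤ ε * Real.log 2 / 6 := min_le_right _ _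
  have hδlog : 0 < δ * Real.log 2 := by positivity
  obtain ⟨τ, ζ, hτ0, hτ1, hζ0, hζ1, htq, hτe, hζL⟩ := exists_distortion (δ := δ * Real.log 2)
    hq0 hq1 hγ0 (by linarith) (by
      rw [← Hb_mul_log_two]; exact mul_lt_mul_of_pos_right hδ1 hlog)
  set t := τ + ζ with ht
  set M := Real.binEntropy q - δ * Real.log 2 with hM
  have hM' : M = (Hb q - δ) * Real.log 2 := by rw [hM, ← Hb_mul_log_two]; ring
  have hM0 : 0 < M := by rw [hM']; exact mul_pos (by linarith) hlog
  -- Exactly the gap between `t * p` and `q * p`, so the decoding ball has radius `r`.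
  set κ := (q - t) * (1 - 2 * p) with hκ
  have hκ0 : 0 < κ := mul_pos (by linarith) (by linarith)
  have hκ1 : κ ≤ 1 := by rw [hκ]; nlinarith
  have hconv : conv t p + κ = r := by rw [hκ, hr]; unfold conv; ring
  set η := min (ε / 4) (1 / 2) with hη
  have hη0 : 0 < η := lt_min (by linarith) (by norm_num)
  have hηε : η ≤ ε / 4 := min_le_left _ _
  have hη2 : η ≤ 1 / 2 := min_le_right _ _
  have hev := ((((eventually_exp_neg_mul_le (c := ζ ^ 2 / 4) (d := 1 / 4) (by positivity)
    (by norm_num)).and (eventually_exp_neg_mul_le (c := γ / 2) (d := ε * η / 8) (by positivity)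
    (by positivity))).and (eventually_exp_neg_mul_le (c := κ ^ 2 / 4) (d := ε / 4) (by positivity)
    (by positivity))).and (tendsto_natCast_atTop_atTop.eventually_ge_atTop (8 / ε)))
  obtain ⟨k₀, hk₀⟩ := eventually_atTop.mp hev
  set k := k₀ + 1
  set n := b * k with hn
  have hkn : k₀ ≤ n := by
    have : 1 * k ≤ b * k := Nat.mul_le_mul_right _ hb
    omega
  obtain ⟨⟨⟨hn1, hn2⟩, hn3⟩, hn4⟩ := hk₀ n hkn
  rw [← mul_div_assoc] at hn1 hn2 hn3
  have hnpos : 0 < n := Nat.mul_pos hb (Nat.succ_pos _)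
  have hn0 : (0 : ℝ) < n := Nat.cast_pos.mpr hnpos
  have hn8 : 8 ≤ ε * n := by rwa [div_le_iff₀' hε] at hn4
  have hbR : (0 : ℝ) < b := Nat.cast_pos.mpr hb
  have hHr0 := Hb_nonneg hr0.le (show r ≤ 1 by linarith)
  have hab' : a ≤ b := by
    have : (a : ℝ) / b ≤ 1 := by rw [hab]; linarith
    rw [div_le_one hbR] at this
    exact_mod_cast this
  set m := (b - a) * k with hm
  have hmR : (m : ℝ) = n * (Hb r + δ) := by
    have : Hb r + δ = 1 - a / b := by rw [hab]; ring
    rw [this, hm, hn]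
    push_cast [Nat.cast_sub hab']
    field_simp
  have hmn : m < n := Nat.mul_lt_mul_of_pos_right (by omega) (Nat.succ_pos _)
  set m₁ := ⌊n * (Hb q - δ)⌋₊ with hm₁
  have hfl : (m₁ : ℝ) ≤ n * (Hb q - δ) := Nat.floor_le (mul_nonneg hn0.le (by linarith))
  have hfu : n * (Hb q - δ) < m₁ + 1 := Nat.lt_floor_add_one _
  have hm₁m : m₁ ≤ m := by
    have : (m₁ : ℝ) ≤ m := by
      rw [hmR]
      exact hfl.trans (mul_le_mul_of_nonneg_left (by linarith) hn0.le)
    exact_mod_cast this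
  obtain ⟨m₂, hm₂⟩ := Nat.exists_eq_add_of_le hm₁m
  have hm₂R : (m : ℝ) = m₁ + m₂ := by exact_mod_cast hm₂
  have hm₁u : m₁ * Real.log 2 ≤ n * M := by
    rw [hM', ← mul_assoc]; exact mul_le_mul_of_nonneg_right hfl hlog.le
  have hm₁l : n * M - Real.log 2 ≤ m₁ * Real.log 2 := by
    have := mul_le_mul_of_nonneg_right hfu.le hlog.le
    rw [hM']; linarith
  have hratio : (m₂ : ℝ) / n ≤ Hb r - Hb q + 2 * δ + ε := by
    rw [div_le_iff₀ hn0]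
    linarith
  have hcard_t : ((ball n t).card : ℝ) ≤ Real.exp (n * (M + 3 * γ / 2)) := by
    refine (card_ball_le hτ0 hτ1).trans (Real.exp_le_exp.mpr ?_)
    refine mul_le_mul_of_nonneg_left ?_ hn0.le
    linarith
  have hcard_t' : 1 / 2 * Real.exp (n * (M + γ / 2)) ≤ ((ball n t).card : ℝ) := by
    refine le_trans ?_ (le_card_ball hτ0 hτ1 hζ0.le hζ1 (by linarith))
    refine mul_le_mul_of_nonneg_left (Real.exp_le_exp.mpr ?_) (by norm_num)
    refine mul_le_mul_of_nonneg_left ?_ hn0.le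
    linarith
  have hcard_r : ((ball n r).card : ℝ) ≤ Real.exp (n * Real.binEntropy r) := by
    have := card_ball_le (n := n) (ζ := 0) hr0 hr1
    simpa using this
  have hne : (ball n t).Nonempty := by
    rw [← Finset.card_pos, ← Nat.cast_pos (α := ℝ)]
    exact lt_of_lt_of_le (by positivity) hcard_t'
  refine ⟨n, m₁, m₂, δ, hnpos, by omega, hδ0, ?_, ?_, ?_⟩
  · rw [abs_lt]; constructor <;> linarith
  · rw [← hm₂R, hmR, sub_self, abs_zero]; exact one_pos
  set X : ParityPair n m₁ m₂ → ℝ := fun K => missed K (ball n t) / 2 ^ m₁ +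
    (∑ e ∈ ball n t, ∑ z, noise p z * (confusions K (ball n (conv t p + κ)) (e + z) : ℝ)) / 2 ^ m₁
    with hX
  have hY0 : ∀ K : ParityPair n m₁ m₂, 0 ≤ (∑ e ∈ ball n t, ∑ z, noise p z *
      (confusions K (ball n (conv t p + κ)) (e + z) : ℝ)) / 2 ^ m₁ := fun K =>
    div_nonneg (Finset.sum_nonneg fun e _ => Finset.sum_nonneg fun z _ =>
      mul_nonneg (noise_nonneg hp0 (by linarith) z) (Nat.cast_nonneg _)) (by positivity)
  have hM_0 : ∀ K : ParityPair n m₁ m₂, 0 ≤ (missed K (ball n t) : ℝ) / 2 ^ m₁ :=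
    fun K => by positivity
  have hsumX : ∑ K, X K ≤ Fintype.card (ParityPair n m₁ m₂) * (4 * Real.exp (-(n * γ / 2))) := by
    have hq1' : (2 : ℝ) ^ m₁ / (ball n t).card ≤ 2 * Real.exp (-(n * γ / 2)) := by
      rw [div_le_iff₀ (lt_of_lt_of_le (by positivity) hcard_t')]
      calc (2 : ℝ) ^ m₁ ≤ Real.exp (n * M) := by
            rw [two_pow_eq_exp]; exact Real.exp_le_exp.mpr hm₁u
        _ = 2 * Real.exp (-(n * γ / 2)) * (1 / 2 * Real.exp (n * (M + γ / 2))) := by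
            rw [show 2 * Real.exp (-(n * γ / 2)) * (1 / 2 * Real.exp (n * (M + γ / 2))) =
              Real.exp (-(n * γ / 2)) * Real.exp (n * (M + γ / 2)) by ring, ← Real.exp_add]
            congr 1; ring
        _ ≤ _ := mul_le_mul_of_nonneg_left hcard_t' (by positivity)
    have hq2' : ((ball n t).card : ℝ) * (ball n r).card / 2 ^ (m₁ + m₂) / 2 ^ m₁ ≤
        2 * Real.exp (-(n * γ / 2)) := by
      rw [div_div, div_le_iff₀ (by positivity), ← hm₂, two_pow_eq_exp, two_pow_eq_exp m₁]
      calc ((ball n t).card : ℝ) * (ball n r).card ≤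
            Real.exp (n * (M + 3 * γ / 2)) * Real.exp (n * Real.binEntropy r) := by gcongr
        _ ≤ Real.exp (Real.log 2) * Real.exp (-(n * γ / 2)) *
            (Real.exp (m * Real.log 2) * Real.exp (m₁ * Real.log 2)) := by
          rw [← Real.exp_add, ← Real.exp_add, ← Real.exp_add, ← Real.exp_add]
          refine Real.exp_le_exp.mpr ?_
          have h1 : m * Real.log 2 = n * Real.binEntropy r + n * (δ * Real.log 2) := by
            rw [hmR, ← Hb_mul_log_two]; ring
          rw [h1]
          have h2 : n * (2 * γ) ≤ n * (δ * Real.log 2) :=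
            mul_le_mul_of_nonneg_left (by linarith) hn0.le
          linarith
        _ = _ := by rw [Real.exp_log two_pos]
    have h1 := sum_missed_le (m₁ := m₁) (m₂ := m₂) (ball n t) hne
    have h2 := sum_sum_noise_mul_confusions_le (m₁ := m₁) (m₂ := m₂) hp0
      (show p ≤ 1 by linarith) (ball n t) (ball n r)
    rw [hX, Finset.sum_add_distrib, ← Finset.sum_div, ← Finset.sum_div, hconv]
    have h3 := div_le_div_of_nonneg_right h1 (show (0 : ℝ) ≤ 2 ^ m₁ by positivity)
    have h4 := div_le_div_of_nonneg_right h2 (show (0 : ℝ) ≤ 2 ^ m₁ by positivity)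
    rw [mul_div_assoc, mul_div_cancel_left₀ _ (by positivity)] at h3
    rw [mul_div_assoc] at h4
    have hN : (0 : ℝ) ≤ Fintype.card (ParityPair n m₁ m₂) := Nat.cast_nonneg _
    calc _ ≤ _ := add_le_add h3 h4
      _ ≤ Fintype.card (ParityPair n m₁ m₂) * (2 * Real.exp (-(n * γ / 2))) +
          Fintype.card (ParityPair n m₁ m₂) * (2 * Real.exp (-(n * γ / 2))) :=
        add_le_add (mul_le_mul_of_nonneg_left hq1' hN) (mul_le_mul_of_nonneg_left hq2' hN)
      _ = _ := by ring
  refine le_trans ?_ (one_sub_le_successProb (by omega) hη0 X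
    (fun K => add_nonneg (hM_0 K) (hY0 K)) hsumX ?_)
  · have : 2 * (4 * Real.exp (-(n * γ / 2))) / η ≤ ε := by
      rw [div_le_iff₀ hη0]
      linarith
    linarith
  · intro K hK hXK A
    have hc1 : M + 3 * γ / 2 ≤ Real.log 2 := by
      have : Real.binEntropy q ≤ Real.log 2 := Real.binEntropy_le_log_two
      rw [hM]; linarith
    refine A.satisfies_of_missed_le (t := t) (κ := κ) (c := n * (Real.log 2 - M - 3 * γ / 2))
      (η := η) hp0 hp1.le hκ0.le hκ1 hnpos (by omega) hK ?_ ?_ ?_ ?_ ?_ ?_ ?_ ?_ ?_ ?_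
    · exact mul_nonneg hn0.le (by linarith)
    · exact mul_le_mul_of_nonneg_left (by linarith) hn0.le
    · refine hcard_t.trans (le_of_eq ?_)
      congr 1; ring
    · linarith [hY0 K]
    · linarith [hM_0 K]
    · rw [sub_sub, ← hm₂R, hmR, hab]
      field_simp
      ring
    · linarith
    · have h1 : n * (3 * γ / 2) ≤ n * (ε * Real.log 2 / 4) :=
        mul_le_mul_of_nonneg_left (by linarith) hn0.le
      have h2 : η * (n * Real.log 2) ≤ ε / 4 * (n * Real.log 2) :=
        mul_le_mul_of_nonneg_right hηε (by positivity)
      have h3 : 8 * Real.log 2 ≤ ε * n * Real.log 2 := mul_le_mul_of_nonneg_right hn8 hlog.le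
      linarith
    · linarith
    · linarith

theorem mem_wzRegion_of_pos (hp0 : 0 ≤ p) (hp1 : p < 1 / 2) {q Rs Rl Rw : ℝ}
    (hq : q ∈ Set.Icc (0 : ℝ) (1 / 2)) (hRs : 0 < Rs) (hr : Hb (conv q p) = 1 - Rs)
    (hl : Hb (conv q p) - Hb q ≤ Rl) (hw : Hb (conv q p) - Hb q ≤ Rw) :
    (Rs, Rl, Rw) ∈ wzRegion p := by
  refine Metric.mem_closure_iff.mpr fun η hη => ?_
  have hq12 : q < 1 / 2 := hq.2.lt_of_ne fun h => by
    have : conv q p = 1 / 2 := by rw [h]; unfold conv; ring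
    rw [this, Hb_half] at hr
    linarith
  have hcont : Tendsto (fun x => Hb (conv x p)) (𝓝[>] q) (𝓝 (1 - Rs)) := by
    rw [← hr]
    exact ((continuous_Hb.comp (continuous_conv_left p)).tendsto q).mono_left nhdsWithin_le_nhds
  have hmin : 0 < min (η / 2) Rs := lt_min (by linarith) hRs
  -- Moving right makes the distortion positive, even if `q = 0`, and does not raise the helper-data
  -- rate.
  obtain ⟨q', hq'1, hq'2⟩ := ((hcont.eventually_lt_const
    (show 1 - Rs < 1 - Rs + min (η / 2) Rs by linarith)).and
    (Ioo_mem_nhdsGT hq12)).exists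
  have hq'0 : 0 < q' := hq.1.trans_lt hq'2.1
  have hmono := antitoneOn_Hb_conv_sub_Hb hp0 hp1.le hq ⟨hq'0.le, hq'2.2.le⟩ hq'2.1.le
  simp only at hmono
  have hge : 1 - Rs ≤ Hb (conv q' p) := by
    rw [← hr]
    refine Hb_le_Hb (hq.1.trans (le_conv hp0 hq.2)) ?_ (conv_le_half hp1.le hq'2.2.le)
    unfold conv
    nlinarith [hq'2.1]
  have hm1 := min_le_left (η / 2) Rs
  have hm2 := min_le_right (η / 2) Rs
  set R := 1 - Hb (conv q' p) with hR
  have hRpos : 0 < R := by linarith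
  have hHq' : 0 < Hb q' := Hb_pos hq'0 (by linarith [hq'2.2])
  -- The gap `δ = R - ρ` must be below `Hb q'` for `m₁` to be meaningful, and below `η / 4` so that
  -- the shift `2 * δ` stays within `η`.
  obtain ⟨ρ, hρ1, hρ2⟩ := exists_rat_btwn
    (show max 0 (R - min (η / 4) (Hb q')) < R from max_lt hRpos
      (by linarith [lt_min (show 0 < η / 4 by linarith) hHq']))
  have hρ0 : (0 : ℝ) < ρ := (le_max_left _ _).trans_lt hρ1
  have hρ3 := (le_max_right _ _).trans_lt hρ1
  have hm3 := min_le_left (η / 4) (Hb q')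
  have hm4 := min_le_right (η / 4) (Hb q')
  have hρq : 0 < ρ := by exact_mod_cast hρ0
  have hnum : 0 < ρ.num := Rat.num_pos.mpr hρq
  have hcast : ((ρ.num.toNat : ℕ) : ℝ) / (ρ.den : ℕ) = ρ := by
    have h1 : ((ρ.num.toNat : ℕ) : ℝ) = (ρ.num : ℝ) := by
      exact_mod_cast Int.toNat_of_nonneg hnum.le
    rw [h1, Rat.cast_def]
  set δ := R - ρ with hδ
  have hach := mem_wzAchievable (p := p) (q := q') (δ := δ) (Rl := Rl + 2 * δ) (Rw := Rw + 2 * δ)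
    (a := ρ.num.toNat) (b := ρ.den) hp0 hp1 hq'0 hq'2.2 (by linarith) (by linarith)
    (by omega) ρ.den_pos (by rw [hcast, hδ, hR]; ring) (by linarith) (by linarith)
  refine ⟨_, hach, ?_⟩
  rw [hcast, Prod.dist_eq, Prod.dist_eq, max_lt_iff, max_lt_iff]
  simp only [Real.dist_eq, abs_lt]
  refine ⟨⟨?_, ?_⟩, ⟨?_, ?_⟩, ?_, ?_⟩ <;> linarith

end Achievability

end KeyAgreement

/-! ### The inclusion of regions -/

theorem theorem3 (p : ℝ) (hp : p ∈ Set.Icc (0 : ℝ) (1 / 2)) :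
    KeyAgreement.binRegion p ⊆ KeyAgreement.wzRegion p := by
  open KeyAgreement in
  rintro ⟨Rs, Rl, Rw⟩ ⟨q, hq, hRs0, hRs1, hl, hw⟩
  simp only at hRs0 hRs1 hl hw
  have hcont : ContinuousOn (fun x => Hb (conv x p)) (Set.Icc q (1 / 2)) :=
    (continuous_Hb.comp (continuous_conv_left p)).continuousOn
  have hhalf : Hb (conv (1 / 2) p) = 1 := by
    rw [show conv (1 / 2) p = 1 / 2 by unfold conv; ring, Hb_half]
  -- Raise the distortion until the key-rate bound is tight.
  obtain ⟨q', hq', hq'e⟩ := intermediate_value_Icc hq.2 hcont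
    (show 1 - Rs ∈ Set.Icc (Hb (conv q p)) (Hb (conv (1 / 2) p)) by
      rw [hhalf]; constructor <;> linarith)
  simp only at hq'e
  have hq'm : q' ∈ Set.Icc (0 : ℝ) (1 / 2) := ⟨hq.1.trans hq'.1, hq'.2⟩
  have hmono := antitoneOn_Hb_conv_sub_Hb hp.1 hp.2 hq hq'm hq'.1
  simp only at hmono
  rcases hRs0.eq_or_lt with h | h
  · rw [← h, sub_zero] at hq'e
    rw [hq'e] at hmono
    rw [← h]
    exact subset_closure
      (zero_mem_wzAchievable hp.1 hp.2 hq'm hq'e (hmono.trans hl) (hmono.trans hw))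
  · refine mem_wzRegion_of_pos hp.1 (hp.2.lt_of_ne fun hp2 => ?_) hq'm h hq'e
      (hmono.trans hl) (hmono.trans hw)
    have : conv q' p = 1 / 2 := by rw [hp2]; unfold conv; ring
    rw [this, Hb_half] at hq'e
    linarith
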